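/- Let $d\in\mathbb N$ and write points of $\mathbb R^{2d}=\mathbb R^d\times\mathbb R^d$ as $z=(x,\xi)$. Let $\sigma((x,\xi),(x',\xi'))=x'\cdot\xi-x\cdot\xi'$ and let $$\mathcal F_\sigma F(w)=\int_{\mathbb R^{2d}}F(z)e^{-2\pi i\sigma(w,z)}\,dz$$ be the symplectic Fourier transform, extended to tempered distributions by duality. For $b\in\mathcal S'(\mathbb R^{2d})$ let $L_b:\mathcal S(\mathbb R^d)\to\mathcal S'(\mathbb R^d)$ be its Weyl quantization, i.e. the operator $L_b=\rho(\mathcal F_\sigma b)$, where, for $u\in\mathcal S'(\mathbb R^{2d})$, $\rho(u)$ is the operator $\mathcal S(\mathbb R^d)\to\mathcal S'(\mathbb R^d)$ with Schwartz kernel $$k_u(t,x)=(\mathcal F^{\xi}u)\Big(t-x,-\frac{t+x}{2}\Big),$$ $\mathcal F^\xi F(x,\eta)=\int F(x,\xi)e^{-2\pi i\xi\cdot\eta}\,d\xi$ denoting the partial Fourier transform in $\xi$, extended to $\mathcal S'(\mathbb R^{2d})$. Say that $L_b\in\mathcal S^p$ if $L_b$ maps $\mathcal S(\mathbb R^d)$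 into $L^2(\mathbb R^d)$, boundedly in the $L^2$-norm, and its bounded extension $T$ to $L^2(\mathbb R^d)$ lies in $\mathcal S^p$; then $\|L_b\|_{\mathcal S^p}:=\|T\|_{\mathcal S^p}$. Here, for $1\le p<\infty$, $\mathcal S^p$ is the Schatten class of compact operators $T$ on $L^2(\mathbb R^d)$ with $\|T\|_{\mathcal S^p}=(\operatorname{tr}|T|^p)^{1/p}<\infty$, and $\mathcal S^\infty$ is the space of all bounded operators on $L^2(\mathbb R^d)$ with the operator norm. For $F\in\mathcal S(\mathbb R^{2d})$ and $N\in\mathbb N$ put $$\|F\|_{(N,2)}=\sum_{|\alpha|+|\beta|\le N}\|\partial^\alpha(z^\beta F)\|_{L^2(\mathbb R^{2d})},\qquad \alpha,\beta\in\mathbb N^{2d}.$$ **Theorem.** There is a constant $C>0$, depending only on $d$, such that for every $\varphi\in\mathcal S(\mathbb R^{2d})$, every $1\le p\le\infty$ and every $a\in L^p(\mathbb R^{2d})$, the operator $M_a:=L_{a*\varphi}$ lies in $\mathcal S^p$ and $$\|M_a\|_{\mathcal S^p}\le C\,\|\mathcal F_\sigma\varphi\|_{(4d+2,2)}\,\|a\|_{L^p(\mathbb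 R^{2d})}.$$ -/

import Mathlib

open SchwartzMap MeasureTheory
open scoped ENNReal Real FourierTransform InnerProductSpace ContDiff
set_option linter.unusedSectionVars false

noncomputable section
namespace WeylCalc

section PartialFourier

variable {V W E : Type} [NormedAddCommGroup V] [NormedSpace ℝ V]
  [NormedAddCommGroup W] [InnerProductSpace ℝ W] [FiniteDimensional ℝ W]
  [MeasurableSpace W] [BorelSpace W]
  [NormedAddCommGroup E] [NormedSpace ℝ E] [NormedSpace ℂ E] [IsScalarTower ℝ ℂ E]

/-- The partial Fourier transform in the second variable,
`(x, η) ↦ ∫ F (x, ξ) exp (-2 π i ξ · η) dξ`. -/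
def partialFourierFun (F : V × W → E) (z : V × W) : E :=
  ∫ ξ, 𝐞 (-⟪ξ, z.2⟫_ℝ) • F (z.1, ξ)

lemma slice_growth (x : V) : Function.HasTemperateGrowth (fun w : W => (x, w)) := by
  have h : (fun w : W => (x, w)) =
      fun w => (x, (0 : W)) + ContinuousLinearMap.inr ℝ V W w := by
    funext w; simp
  rw [h]
  exact (Function.HasTemperateGrowth.const _).add
    (ContinuousLinearMap.inr ℝ V W).hasTemperateGrowth

lemma slice_antilipschitz (x : V) : AntilipschitzWith 1 (fun w : W => (x, w)) := by
  refine AntilipschitzWith.of_le_mul_dist fun a b => ?_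
  simp [Prod.dist_eq]

/-- The function `F (x, ·)` for a fixed first variable. -/
def slice (x : V) (F : 𝓢(V × W, E)) : 𝓢(W, E) :=
  compCLMOfAntilipschitz ℂ (slice_growth x) (slice_antilipschitz x) F

@[simp] lemma slice_apply (x : V) (F : 𝓢(V × W, E)) (w : W) : slice x F w = F (x, w) := rfl

lemma partialFourierFun_eq {E : Type} [NormedAddCommGroup E] [NormedSpace ℂ E]
    (F : 𝓢(V × W, E)) (z : V × W) :
    partialFourierFun F z = 𝓕 (slice z.1 F) z.2 := by
  rw [SchwartzMap.fourier_coe, Real.fourier_eq]; rfl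

lemma slice_seminorm (F : 𝓢(V × W, E)) (x : V) (m a b : ℕ) :
    ‖x‖ ^ m * SchwartzMap.seminorm ℂ a b (slice x F) ≤ SchwartzMap.seminorm ℂ (m + a) b F := by
  have key : ∀ w : W, ‖iteratedFDeriv ℝ b (slice x F) w‖ ≤ ‖iteratedFDeriv ℝ b F (x, w)‖ := by
    intro w
    have h : (slice x F : W → E) =
        (fun z => F ((x, (0 : W)) + z)) ∘ (ContinuousLinearMap.inr ℝ V W) := by
      funext w; simp
    have hs : ContDiff ℝ ∞ (fun z => F ((x, (0 : W)) + z)) :=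
      (F.smooth ⊤).comp (contDiff_const.add contDiff_id)
    rw [h, ContinuousLinearMap.iteratedFDeriv_comp_right _ hs _ (mod_cast le_top),
      iteratedFDeriv_comp_add_left]
    refine (ContinuousMultilinearMap.norm_compContinuousLinearMap_le _ _).trans ?_
    have h1 : ‖ContinuousLinearMap.inr ℝ V W‖ ≤ 1 := ContinuousLinearMap.norm_inr_le_one ℝ V W
    have h2 : (x, (0 : W)) + ContinuousLinearMap.inr ℝ V W w = (x, w) := by simp
    rw [h2]
    refine mul_le_of_le_one_right (norm_nonneg _) ?_
    exact Finset.prod_le_one (fun _ _ => norm_nonneg _) (fun _ _ => h1)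
  rcases (norm_nonneg x).eq_or_lt with h0 | h0
  · rcases Nat.eq_zero_or_pos m with rfl | hm
    · simp only [pow_zero, one_mul, zero_add]
      refine seminorm_le_bound ℂ _ _ _ (by positivity) fun w => ?_
      refine le_trans ?_ (le_seminorm ℂ a b F (x, w))
      gcongr
      · exact le_max_right _ _
      · exact key w
    · rw [← h0, zero_pow hm.ne', zero_mul]; positivity
  · rw [← le_div_iff₀' (by positivity)]
    refine seminorm_le_bound ℂ _ _ _ (by positivity) fun w => ?_
    rw [le_div_iff₀' (by positivity)]
    refine le_trans ?_ (le_seminorm ℂ (m + a) b F (x, w))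
    rw [pow_add, ← mul_assoc]
    gcongr
    · exact le_max_left _ _
    · exact le_max_right _ _
    · exact key w

lemma partialFourier_bound_zero (k : ℕ) : ∃ q : Seminorm ℂ 𝓢(V × W, E), Continuous q ∧
    ∀ (F : 𝓢(V × W, E)) (z : V × W), ‖z‖ ^ k * ‖partialFourierFun F z‖ ≤ q F := by
  obtain rfl : ‹NormedSpace ℝ E› = NormedSpace.complexToReal := by
    ext r x
    exact (RCLike.real_smul_eq_coe_smul (K := ℂ) r x)
  have aux : ∀ a m : ℕ, ∃ q : Seminorm ℂ 𝓢(V × W, E), Continuous q ∧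
      ∀ (F : 𝓢(V × W, E)) (z : V × W),
        ‖z.1‖ ^ m * (‖z.2‖ ^ a * ‖partialFourierFun F z‖) ≤ q F := by
    intro a m
    let q₀ : Seminorm ℂ 𝓢(W, E) := (SchwartzMap.seminorm ℂ a 0).comp
      (FourierTransform.fourierCLM ℂ 𝓢(W, E) : 𝓢(W, E) →ₗ[ℂ] 𝓢(W, E))
    have hq₀ : Continuous q₀ :=
      ((schwartz_withSeminorms ℂ W E).continuous_seminorm (a, 0)).comp
        (FourierTransform.fourierCLM ℂ 𝓢(W, E)).continuous
    obtain ⟨s, C, -, hC⟩ := Seminorm.bound_of_continuous (schwartz_withSeminorms ℂ W E) q₀ hq₀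
    refine ⟨C • ∑ i ∈ s, SchwartzMap.seminorm ℂ (m + i.1) i.2, ?_, fun F z => ?_⟩
    · have : ((C • ∑ i ∈ s, SchwartzMap.seminorm ℂ (m + i.1) i.2 : Seminorm ℂ 𝓢(V × W, E)) :
          𝓢(V × W, E) → ℝ) =
          fun F => (C : ℝ) * ∑ i ∈ s, SchwartzMap.seminorm ℂ (m + i.1) i.2 F := by
        funext F
        simp [NNReal.smul_def]
      rw [this]
      refine continuous_const.mul (continuous_finsetSum _ fun i _ => ?_)
      exact (schwartz_withSeminorms ℂ (V × W) E).continuous_seminorm (m + i.1, i.2)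
    · have h1 : ‖z.2‖ ^ a * ‖partialFourierFun F z‖ ≤ q₀ (slice z.1 F) := by
        rw [partialFourierFun_eq]
        exact norm_pow_mul_le_seminorm ℂ (𝓕 (slice z.1 F)) a z.2
      have h2 : q₀ (slice z.1 F) ≤
          (C : ℝ) * ∑ i ∈ s, SchwartzMap.seminorm ℂ i.1 i.2 (slice z.1 F) := by
        refine (hC (slice z.1 F)).trans ?_
        have := Seminorm.finset_sup_le_sum (schwartzSeminormFamily ℂ W E) s (slice z.1 F)
        rw [smul_apply, NNReal.smul_def, smul_eq_mul]
        refine mul_le_mul_of_nonneg_left (this.trans_eq ?_) C.2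
        simp [schwartzSeminormFamily]
      calc _ ≤ ‖z.1‖ ^ m * ((C : ℝ) * ∑ i ∈ s, SchwartzMap.seminorm ℂ i.1 i.2 (slice z.1 F)) := by
            exact mul_le_mul_of_nonneg_left (h1.trans h2) (by positivity)
        _ = (C : ℝ) * ∑ i ∈ s, ‖z.1‖ ^ m * SchwartzMap.seminorm ℂ i.1 i.2 (slice z.1 F) := by
            simp only [Finset.mul_sum]
            refine Finset.sum_congr rfl fun i _ => ?_
            ring
        _ ≤ (C : ℝ) * ∑ i ∈ s, SchwartzMap.seminorm ℂ (m + i.1) i.2 F := by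
            gcongr with i _
            exact slice_seminorm F z.1 m i.1 i.2
        _ = _ := by simp [NNReal.smul_def]
  obtain ⟨q₁, hq₁, h₁⟩ := aux 0 k
  obtain ⟨q₂, hq₂, h₂⟩ := aux k 0
  refine ⟨q₁ + q₂, hq₁.add hq₂, fun F z => ?_⟩
  have e1 := h₁ F z
  have e2 := h₂ F z
  simp only [pow_zero, one_mul] at e1 e2
  rw [add_apply]
  rcases max_choice ‖z.1‖ ‖z.2‖ with h | h
  · rw [Prod.norm_def, h]
    have := apply_nonneg q₂ F
    linarith
  · rw [Prod.norm_def, h]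
    have := apply_nonneg q₁ F
    linarith

/-- Restriction of a linear form to the first factor. -/
def fstPart : (V × W →L[ℝ] E) →L[ℂ] (V × W →L[ℝ] E) where
  toFun A := A.comp ((ContinuousLinearMap.inl ℝ V W).comp (ContinuousLinearMap.fst ℝ V W))
  map_add' _ _ := rfl
  map_smul' _ _ := rfl
  cont := ((ContinuousLinearMap.compL ℝ (V × W) (V × W) E).flip
    ((ContinuousLinearMap.inl ℝ V W).comp (ContinuousLinearMap.fst ℝ V W))).continuous

/-- The total derivative of the integrand of the partial Fourier transform, without the
exponential factor. -/
def partialFourierDeriv : 𝓢(V × W, E) →L[ℂ] 𝓢(V × W, V × W →L[ℝ] E) :=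
  (postcompCLM (𝕜 := ℂ) fstPart).comp (fderivCLM ℂ (V × W) E) +
  (-(2 * π * Complex.I) : ℂ) • smulRightCLM ℂ E
    ((innerSL ℝ : W →L[ℝ] W →L[ℝ] ℝ).bilinearComp
      (ContinuousLinearMap.snd ℝ V W) (ContinuousLinearMap.snd ℝ V W))

lemma partialFourierDeriv_apply (F : 𝓢(V × W, E)) (z v : V × W) :
    partialFourierDeriv F z v =
      fderiv ℝ F z (v.1, 0) + (-(2 * π * Complex.I) : ℂ) • (⟪z.2, v.2⟫_ℝ • F z) := by
  have h : fstPart (fderiv ℝ F z) v = fderiv ℝ F z (v.1, 0) := rfl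
  simp [partialFourierDeriv, h]

lemma partialFourier_integrand_hasFDerivAt (F : 𝓢(V × W, E)) (ξ : W) (z : V × W) :
    HasFDerivAt (fun z : V × W => 𝐞 (-⟪ξ, z.2⟫_ℝ) • F (z.1, ξ))
      (𝐞 (-⟪ξ, z.2⟫_ℝ) • partialFourierDeriv F (z.1, ξ)) z := by
  have h1 : HasFDerivAt (fun z : V × W => F (z.1, ξ))
      ((fderiv ℝ F (z.1, ξ)).comp
        ((ContinuousLinearMap.inl ℝ V W).comp (ContinuousLinearMap.fst ℝ V W))) z := by
    refine (F.hasFDerivAt (z.1, ξ)).comp z ?_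
    have := (ContinuousLinearMap.inl ℝ V W).hasFDerivAt.comp z
      (ContinuousLinearMap.fst ℝ V W).hasFDerivAt
    have h3 := this.add_const ((0 : V), ξ)
    refine h3.congr_of_eventuallyEq (Filter.Eventually.of_forall fun y => ?_)
    simp
  have h2 : HasFDerivAt (fun z : V × W => ((𝐞 (-⟪ξ, z.2⟫_ℝ) : Circle) : ℂ))
      ((VectorFourier.fourierSMulRight (innerSL ℝ) (fun _ : W => (𝐞 (-⟪ξ, z.2⟫_ℝ) : ℂ)) ξ).comp
        (ContinuousLinearMap.snd ℝ V W)) z := by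
    have hi : ∀ a b : W, (innerSL ℝ : W →L[ℝ] W →L[ℝ] ℝ) a b = ⟪a, b⟫_ℝ := fun _ _ => rfl
    have h := VectorFourier.hasFDerivAt_fourierChar_smul (innerSL ℝ : W →L[ℝ] W →L[ℝ] ℝ)
      (fun _ : W => (1 : ℂ)) ξ z.2
    have h' := h.comp z (ContinuousLinearMap.snd ℝ V W).hasFDerivAt
    refine (h'.congr_of_eventuallyEq (Filter.Eventually.of_forall fun y => ?_)).congr_fderiv ?_
    · simp [Circle.smul_def, hi]
    · ext v <;> simp [Circle.smul_def, hi]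
      ring
  have h := h2.smul h1
  refine h.congr_fderiv ?_
  ext v
  · simp [partialFourierDeriv_apply, Circle.smul_def]
  · simp [partialFourierDeriv_apply, Circle.smul_def, smul_smul]
    have hi : (innerSL ℝ : W →L[ℝ] W →L[ℝ] ℝ) ξ v = ⟪ξ, v⟫_ℝ := rfl
    rw [hi, RCLike.real_smul_eq_coe_smul (K := ℂ), smul_smul]
    congr 1
    simp only [Complex.coe_algebraMap]
    ring

lemma partialFourier_integrable (F : 𝓢(V × W, E)) (z : V × W) :
    Integrable (fun ξ : W => 𝐞 (-⟪ξ, z.2⟫_ℝ) • F (z.1, ξ)) := by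
  have h : Continuous fun ξ : W => 𝐞 (-⟪ξ, z.2⟫_ℝ) := by fun_prop
  refine (slice z.1 F).integrable.mono ?_ (Filter.Eventually.of_forall fun ξ => ?_)
  · exact (h.smul (slice z.1 F).continuous).aestronglyMeasurable
  · rw [Circle.norm_smul]; rfl

lemma norm_char_smul (r : ℝ) (e : E) : ‖𝐞 r • e‖ = ‖e‖ := by
  rw [Circle.norm_smul]

lemma schwartz_snd_decay {G' : Type} [NormedAddCommGroup G'] [NormedSpace ℝ G']
    (G : 𝓢(V × W, G')) (l : ℕ) :
    ∃ C : ℝ, ∀ x ξ, ‖G (x, ξ)‖ ≤ C * (1 + ‖ξ‖) ^ (-(l : ℝ)) := by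
  refine ⟨2 ^ l * ((Finset.Iic (l, 0)).sup fun m => SchwartzMap.seminorm ℝ m.1 m.2) G,
    fun x ξ => ?_⟩
  rw [Real.rpow_neg (by positivity), Real.rpow_natCast, ← div_eq_mul_inv,
    le_div_iff₀ (by positivity)]
  have h := one_add_le_sup_seminorm_apply (𝕜 := ℝ) (m := (l, 0)) (le_refl l) (le_refl 0)
    G (x, ξ)
  rw [norm_iteratedFDeriv_zero] at h
  refine le_trans ?_ h
  rw [mul_comm]
  gcongr
  exact le_max_right _ _

lemma partialFourier_hasFDerivAt (F : 𝓢(V × W, E)) (z : V × W) :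
    HasFDerivAt (partialFourierFun F) (partialFourierFun (partialFourierDeriv F) z) z := by
  obtain ⟨l, hl⟩ := (inferInstance : (volume : Measure W).HasTemperateGrowth).exists_integrable
  obtain ⟨C, hC⟩ := schwartz_snd_decay (partialFourierDeriv F) l
  have h1 := partialFourier_integrable F
  have h2 : AEStronglyMeasurable (fun ξ : W => 𝐞 (-⟪ξ, z.2⟫_ℝ) • partialFourierDeriv F (z.1, ξ))
      (volume : Measure W) := (partialFourier_integrable (partialFourierDeriv F) z).1
  have h3 : ∀ᵐ ξ ∂(volume : Measure W), ∀ y ∈ (Set.univ : Set (V × W)),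
      ‖𝐞 (-⟪ξ, y.2⟫_ℝ) • partialFourierDeriv F (y.1, ξ)‖ ≤ C * (1 + ‖ξ‖) ^ (-(l : ℝ)) :=
    Filter.Eventually.of_forall fun ξ y _ =>
      (norm_char_smul _ (partialFourierDeriv F (y.1, ξ))).trans_le (hC y.1 ξ)
  have h4 : ∀ᵐ ξ ∂(volume : Measure W), ∀ y ∈ (Set.univ : Set (V × W)),
      HasFDerivAt (fun z : V × W => 𝐞 (-⟪ξ, z.2⟫_ℝ) • F (z.1, ξ))
      (𝐞 (-⟪ξ, y.2⟫_ℝ) • partialFourierDeriv F (y.1, ξ)) y :=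
    Filter.Eventually.of_forall fun ξ y _ => partialFourier_integrand_hasFDerivAt F ξ y
  exact hasFDerivAt_integral_of_dominated_of_fderiv_le (𝕜 := ℝ) Filter.univ_mem
    (Filter.Eventually.of_forall fun y => (h1 y).aestronglyMeasurable) (h1 z) h2 h3
    (hl.const_mul C) h4

end PartialFourier

section Bounds

variable {V W : Type} [NormedAddCommGroup V] [NormedSpace ℝ V]
  [NormedAddCommGroup W] [InnerProductSpace ℝ W] [FiniteDimensional ℝ W]
  [MeasurableSpace W] [BorelSpace W]

lemma partialFourier_fderiv {E : Type} [NormedAddCommGroup E] [NormedSpace ℝ E] [NormedSpace ℂ E] [IsScalarTower ℝ ℂ E]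
    (F : 𝓢(V × W, E)) :
    fderiv ℝ (partialFourierFun F) = partialFourierFun (partialFourierDeriv F) :=
  funext fun z => (partialFourier_hasFDerivAt F z).fderiv

lemma partialFourier_contDiff_nat (n : ℕ) : ∀ {E : Type} [NormedAddCommGroup E] [NormedSpace ℝ E] [NormedSpace ℂ E] [IsScalarTower ℝ ℂ E]
    (F : 𝓢(V × W, E)), ContDiff ℝ n (partialFourierFun F) := by
  induction n with
  | zero =>
    intro E _ _ _ _ F
    rw [Nat.cast_zero, contDiff_zero]
    exact continuous_iff_continuousAt.2 fun z => (partialFourier_hasFDerivAt F z).continuousAt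
  | succ n ih =>
    intro E _ _ _ _ F
    have : ((n + 1 : ℕ) : WithTop ℕ∞) = (n : WithTop ℕ∞) + 1 := by norm_cast
    rw [this, contDiff_succ_iff_fderiv]
    refine ⟨fun z => (partialFourier_hasFDerivAt F z).differentiableAt, by simp, ?_⟩
    rw [partialFourier_fderiv]
    exact ih _

lemma partialFourier_bound (k n : ℕ) : ∀ {E : Type} [NormedAddCommGroup E] [NormedSpace ℝ E] [NormedSpace ℂ E] [IsScalarTower ℝ ℂ E],
    ∃ q : Seminorm ℂ 𝓢(V × W, E), Continuous q ∧ ∀ (F : 𝓢(V × W, E)) (z : V × W),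
      ‖z‖ ^ k * ‖iteratedFDeriv ℝ n (partialFourierFun F) z‖ ≤ q F := by
  induction n with
  | zero =>
    intro E _ _ _ _
    simpa only [norm_iteratedFDeriv_zero] using partialFourier_bound_zero k
  | succ n ih =>
    intro E _ _ _ _
    obtain ⟨q, hq, h⟩ := ih (E := V × W →L[ℝ] E)
    let D := partialFourierDeriv (V := V) (W := W) (E := E)
    let q' : Seminorm ℂ 𝓢(V × W, E) := q.comp D.toLinearMap
    have hq' : Continuous q' := by
      have h0 : (q' : 𝓢(V × W, E) → ℝ) = fun F => q (D F) := rfl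
      rw [h0]
      exact hq.comp D.continuous
    refine ⟨q', hq', fun F z => ?_⟩
    rw [← norm_iteratedFDeriv_fderiv, partialFourier_fderiv]
    exact h _ z

/-- The partial Fourier transform in the second variable as a continuous operator on Schwartz
functions. -/
def partialFourier : 𝓢(V × W, ℂ) →L[ℂ] 𝓢(V × W, ℂ) :=
  mkCLM (fun F => partialFourierFun F)
    (fun F G z => by
      simp only [partialFourierFun, add_apply, smul_add]
      exact integral_add (partialFourier_integrable F z) (partialFourier_integrable G z))
    (fun c F z => by
      simp only [partialFourierFun, smul_apply, RingHom.id_apply, ← integral_smul]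
      congr 1; funext ξ; rw [smul_comm])
    (fun F => contDiff_infty.2 fun n => partialFourier_contDiff_nat n F)
    (fun n => by
      obtain ⟨q, hq, h⟩ := partialFourier_bound (V := V) (W := W) n.1 n.2 (E := ℂ)
      obtain ⟨s, C, -, hC⟩ :=
        Seminorm.bound_of_continuous (schwartz_withSeminorms ℂ (V × W) ℂ) q hq
      exact ⟨s, C, C.2, fun F z => (h F z).trans (hC F)⟩)

lemma partialFourier_apply (F : 𝓢(V × W, ℂ)) (x : V) (η : W) :
    partialFourier F (x, η) = ∫ ξ, Complex.exp (-(2 * π * Complex.I * ⟪ξ, η⟫_ℝ)) * F (x, ξ) := by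
  change partialFourierFun F (x, η) = _
  simp only [partialFourierFun, Circle.smul_def, Real.fourierChar_apply, smul_eq_mul]
  congr 1; funext ξ; congr 2; push_cast; ring

end Bounds

section Tensor

variable {V₁ V₂ : Type} [NormedAddCommGroup V₁] [NormedSpace ℝ V₁]
  [NormedAddCommGroup V₂] [NormedSpace ℝ V₂]

lemma norm_iteratedFDeriv_fst_le (f : 𝓢(V₁, ℂ)) (n : ℕ) (z : V₁ × V₂) :
    ‖iteratedFDeriv ℝ n (fun z : V₁ × V₂ => f z.1) z‖ ≤ ‖iteratedFDeriv ℝ n f z.1‖ := by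
  have h := ContinuousLinearMap.iteratedFDeriv_comp_right (ContinuousLinearMap.fst ℝ V₁ V₂)
    (f.smooth ⊤) z (i := n) (mod_cast le_top)
  have h' : iteratedFDeriv ℝ n (fun z : V₁ × V₂ => f z.1) z =
      iteratedFDeriv ℝ n (f ∘ (ContinuousLinearMap.fst ℝ V₁ V₂)) z := rfl
  rw [h', h]
  refine (ContinuousMultilinearMap.norm_compContinuousLinearMap_le _ _).trans ?_
  refine mul_le_of_le_one_right (norm_nonneg _) ?_
  exact Finset.prod_le_one (fun _ _ => norm_nonneg _)
    (fun _ _ => ContinuousLinearMap.norm_fst_le ℝ V₁ V₂)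

lemma norm_iteratedFDeriv_snd_le (f : 𝓢(V₂, ℂ)) (n : ℕ) (z : V₁ × V₂) :
    ‖iteratedFDeriv ℝ n (fun z : V₁ × V₂ => f z.2) z‖ ≤ ‖iteratedFDeriv ℝ n f z.2‖ := by
  have h := ContinuousLinearMap.iteratedFDeriv_comp_right (ContinuousLinearMap.snd ℝ V₁ V₂)
    (f.smooth ⊤) z (i := n) (mod_cast le_top)
  have h' : iteratedFDeriv ℝ n (fun z : V₁ × V₂ => f z.2) z =
      iteratedFDeriv ℝ n (f ∘ (ContinuousLinearMap.snd ℝ V₁ V₂)) z := rfl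
  rw [h', h]
  refine (ContinuousMultilinearMap.norm_compContinuousLinearMap_le _ _).trans ?_
  refine mul_le_of_le_one_right (norm_nonneg _) ?_
  exact Finset.prod_le_one (fun _ _ => norm_nonneg _)
    (fun _ _ => ContinuousLinearMap.norm_snd_le ℝ V₁ V₂)

/-- The tensor product `(f ⊗ g) (x, y) = f x * g y`, continuous in `f`. -/
def tensorLeft (g : 𝓢(V₂, ℂ)) : 𝓢(V₁, ℂ) →L[ℂ] 𝓢(V₁ × V₂, ℂ) :=
  mkCLM (fun f z => f z.1 * g z.2)
    (fun f f' z => by simp [add_mul])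
    (fun c f z => by simp [mul_assoc])
    (fun f => ((f.smooth ⊤).comp contDiff_fst).mul ((g.smooth ⊤).comp contDiff_snd))
    (fun kn => by
      obtain ⟨k, n⟩ := kn
      refine ⟨({0, k} : Finset ℕ) ×ˢ Finset.range (n + 1),
        ∑ i ∈ Finset.range (n + 1), (n.choose i : ℝ) *
          (SchwartzMap.seminorm ℂ 0 (n - i) g + SchwartzMap.seminorm ℂ k (n - i) g),
        by positivity, fun f z => ?_⟩
      set Q := ((({0, k} : Finset ℕ) ×ˢ Finset.range (n + 1)).sup
        (schwartzSeminormFamily ℂ V₁ ℂ)) f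
      have hQ : ∀ j ∈ ({0, k} : Finset ℕ), ∀ i ∈ Finset.range (n + 1),
          SchwartzMap.seminorm ℂ j i f ≤ Q := fun j hj i hi =>
        Seminorm.le_def.1 (Finset.le_sup (f := schwartzSeminormFamily ℂ V₁ ℂ)
          (Finset.mk_mem_product hj hi)) f
      have h1 := norm_iteratedFDeriv_mul_le (𝕜 := ℝ) (n := n) (N := ∞)
        ((f.smooth ⊤).comp (contDiff_fst (E := V₁) (F := V₂)))
        ((g.smooth ⊤).comp (contDiff_snd (E := V₁) (F := V₂))) z (mod_cast le_top)
      have h2 : ‖z‖ ^ k ≤ ‖z.1‖ ^ k + ‖z.2‖ ^ k := by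
        rw [Prod.norm_def]
        rcases max_choice ‖z.1‖ ‖z.2‖ with h | h <;> rw [h]
        · exact le_add_of_nonneg_right (by positivity)
        · exact le_add_of_nonneg_left (by positivity)
      refine (mul_le_mul_of_nonneg_left h1 (by positivity)).trans ?_
      rw [Finset.mul_sum, Finset.sum_mul]
      refine Finset.sum_le_sum fun i hi => ?_
      have hf := norm_iteratedFDeriv_fst_le (V₂ := V₂) f i z
      have hg := norm_iteratedFDeriv_snd_le (V₁ := V₁) g (n - i) z
      have f0 : ‖iteratedFDeriv ℝ i f z.1‖ ≤ Q :=
        (norm_iteratedFDeriv_le_seminorm ℂ f i z.1).trans (hQ 0 (by simp) i hi)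
      have fk : ‖z.1‖ ^ k * ‖iteratedFDeriv ℝ i f z.1‖ ≤ Q :=
        (le_seminorm ℂ k i f z.1).trans (hQ k (by simp) i hi)
      have g0 := norm_iteratedFDeriv_le_seminorm ℂ g (n - i) z.2
      have gk := le_seminorm ℂ k (n - i) g z.2
      have hQ0 : 0 ≤ Q := (norm_nonneg _).trans f0
      calc _ ≤ (‖z.1‖ ^ k + ‖z.2‖ ^ k) * ((n.choose i : ℝ) *
            ‖iteratedFDeriv ℝ i f z.1‖ * ‖iteratedFDeriv ℝ (n - i) g z.2‖) := by
            gcongr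
            · exact hf
            · exact hg
        _ = (n.choose i : ℝ) * ((‖z.1‖ ^ k * ‖iteratedFDeriv ℝ i f z.1‖) *
              ‖iteratedFDeriv ℝ (n - i) g z.2‖ + ‖iteratedFDeriv ℝ i f z.1‖ *
              (‖z.2‖ ^ k * ‖iteratedFDeriv ℝ (n - i) g z.2‖)) := by ring
        _ ≤ (n.choose i : ℝ) * (Q * SchwartzMap.seminorm ℂ 0 (n - i) g +
              Q * SchwartzMap.seminorm ℂ k (n - i) g) := by gcongr
        _ = _ := by ring)

/-- The tensor product `(f ⊗ g) (x, y) = f x * g y`, continuous in `g`. -/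
def tensorRight (f : 𝓢(V₁, ℂ)) : 𝓢(V₂, ℂ) →L[ℂ] 𝓢(V₁ × V₂, ℂ) :=
  (compCLMOfContinuousLinearEquiv ℂ (ContinuousLinearEquiv.prodComm ℝ V₁ V₂)).comp (tensorLeft f)

@[simp] lemma tensorLeft_apply (f : 𝓢(V₁, ℂ)) (g : 𝓢(V₂, ℂ)) (z : V₁ × V₂) :
    tensorLeft g f z = f z.1 * g z.2 := rfl

lemma tensorRight_eq (f : 𝓢(V₁, ℂ)) (g : 𝓢(V₂, ℂ)) : tensorRight f g = tensorLeft g f := by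
  ext z
  exact mul_comm _ _

end Tensor

section FibreIntegral

variable {V W W' : Type} [NormedAddCommGroup V] [NormedSpace ℝ V]
  [NormedAddCommGroup W] [InnerProductSpace ℝ W] [FiniteDimensional ℝ W]
  [MeasurableSpace W] [BorelSpace W]
  [NormedAddCommGroup W'] [InnerProductSpace ℝ W'] [FiniteDimensional ℝ W']
  [MeasurableSpace W'] [BorelSpace W']

instance prodHaar : (volume : Measure (W × W')).IsAddHaarMeasure :=
  Measure.prod.instIsAddHaarMeasure _ _

lemma inl_antilipschitz : AntilipschitzWith 1 (ContinuousLinearMap.inl ℝ V W) := by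
  refine AntilipschitzWith.of_le_mul_dist fun a b => ?_
  simp [Prod.dist_eq]

/-- Integration over the second variable, `x ↦ ∫ F (x, w) dw`. -/
def integrateSnd : 𝓢(V × W, ℂ) →L[ℂ] 𝓢(V, ℂ) :=
  (compCLMOfAntilipschitz ℂ (ContinuousLinearMap.inl ℝ V W).hasTemperateGrowth
    inl_antilipschitz).comp partialFourier

lemma integrateSnd_apply (F : 𝓢(V × W, ℂ)) (x : V) : integrateSnd F x = ∫ w, F (x, w) := by
  have h : integrateSnd F x = partialFourier F (x, 0) := rfl
  rw [h, partialFourier_apply]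
  simp

/-- Integration over a pair of variables, `x ↦ ∫ F (x, w) dw`. -/
def integrateSndProd : 𝓢(V × (W × W'), ℂ) →L[ℂ] 𝓢(V, ℂ) :=
  integrateSnd.comp (integrateSnd.comp
    (compCLMOfContinuousLinearEquiv ℂ (ContinuousLinearEquiv.prodAssoc ℝ V W W')))

lemma slice_integrable_prod (F : 𝓢(V × (W × W'), ℂ)) (x : V) :
    Integrable (fun w : W × W' => F (x, w)) := by
  have h : (fun w : W × W' => (x, w)) =
      fun w => (x, (0 : W × W')) + ContinuousLinearMap.inr ℝ V (W × W') w := by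
    funext w; simp
  have hg : Function.HasTemperateGrowth (fun w : W × W' => (x, w)) := by
    rw [h]
    exact (Function.HasTemperateGrowth.const _).add
      (ContinuousLinearMap.inr ℝ V (W × W')).hasTemperateGrowth
  have ha : AntilipschitzWith 1 (fun w : W × W' => (x, w)) :=
    AntilipschitzWith.of_le_mul_dist fun a b => by simp [Prod.dist_eq]
  exact (compCLMOfAntilipschitz ℂ hg ha F).integrable

lemma integrateSndProd_apply (F : 𝓢(V × (W × W'), ℂ)) (x : V) :
    integrateSndProd F x = ∫ w, F (x, w) := by
  have h : integrateSndProd F x = ∫ w : W, ∫ w' : W', F (x, (w, w')) := by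
    simp only [integrateSndProd, ContinuousLinearMap.comp_apply, integrateSnd_apply]
    rfl
  rw [h, Measure.volume_eq_prod, integral_prod]
  exact slice_integrable_prod F x

end FibreIntegral

/-! ### Phase space and the symplectic Fourier transform -/

/-- Euclidean space `ℝ^d`. -/
abbrev Rn (d : ℕ) : Type := EuclideanSpace ℝ (Fin d)

/-- Phase space `ℝ^{2d} = ℝ^d × ℝ^d`, with points `z = (x, ξ)` and Lebesgue measure. -/
abbrev Phase (d : ℕ) : Type := Rn d × Rn d

variable {d : ℕ}

/-- The symplectic form `σ((x, ξ), (x', ξ')) = x' · ξ - x · ξ'`. -/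
def symplecticForm (z w : Phase d) : ℝ := ⟪w.1, z.2⟫_ℝ - ⟪z.1, w.2⟫_ℝ

/-- The linear change of variables `(y, x) ↦ (x, -y)`. -/
def quarterTurn (d : ℕ) : Phase d ≃L[ℝ] Phase d :=
  (ContinuousLinearEquiv.prodComm ℝ (Rn d) (Rn d)).trans
    ((ContinuousLinearEquiv.refl ℝ (Rn d)).prodCongr (ContinuousLinearEquiv.neg ℝ))

/-- The symplectic Fourier transform `F_σ F (w) = ∫ F z * exp (-2 π i σ(w, z)) dz` on Schwartz
functions (see `symplecticFourier_apply`), built from two partial Fourier transforms. -/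
def symplecticFourier (d : ℕ) : 𝓢(Phase d, ℂ) →L[ℂ] 𝓢(Phase d, ℂ) :=
  partialFourier.comp ((compCLMOfContinuousLinearEquiv ℂ (quarterTurn d)).comp partialFourier)

theorem symplecticFourier_apply (F : 𝓢(Phase d, ℂ)) (w : Phase d) :
    symplecticFourier d F w =
      ∫ z, Complex.exp (-(2 * π * Complex.I * symplecticForm w z)) * F z := by
  obtain ⟨y, η⟩ := w
  have h : symplecticFourier d F (y, η) = ∫ x : Rn d, ∫ ξ : Rn d,
      Complex.exp (-(2 * π * Complex.I * symplecticForm (y, η) (x, ξ))) * F (x, ξ) := by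
    simp only [symplecticFourier, ContinuousLinearMap.comp_apply]
    rw [partialFourier_apply]
    congr 1; funext x
    have h1 : compCLMOfContinuousLinearEquiv ℂ (quarterTurn d) (partialFourier F) (y, x) =
      partialFourier F (x, -y) := rfl
    rw [h1, partialFourier_apply, ← integral_const_mul]
    congr 1; funext ξ
    rw [← mul_assoc, ← Complex.exp_add]
    congr 2
    simp only [symplecticForm, inner_neg_right, real_inner_comm y ξ]
    push_cast
    ring
  rw [h, Measure.volume_eq_prod, integral_prod]
  refine (F.integrable (μ := (volume : Measure (Phase d)))).mono ?_
    (Filter.Eventually.of_forall fun z => ?_)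
  · refine Continuous.aestronglyMeasurable (Continuous.mul ?_ F.continuous)
    unfold symplecticForm
    fun_prop
  · rw [norm_mul, Complex.norm_exp]
    simp

/-- The reflection `z ↦ -z` on Schwartz functions. -/
def reflect (d : ℕ) : 𝓢(Phase d, ℂ) →L[ℂ] 𝓢(Phase d, ℂ) :=
  compCLMOfContinuousLinearEquiv ℂ (ContinuousLinearEquiv.neg ℝ)

/-- The symplectic Fourier transform of a tempered distribution: since `σ(w, z) = σ(-z, w)`,
`⟨F_σ u, F⟩ = ⟨u, z ↦ (F_σ F) (-z)⟩`. -/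
def symplecticFourierDistrib (u : 𝓢'(Phase d, ℂ)) : 𝓢'(Phase d, ℂ) :=
  PointwiseConvergenceCLM.precomp ℂ ((reflect d).comp (symplecticFourier d)) u

/-! ### Convolution of a tempered distribution with a Schwartz function -/

/-- The linear change of variables `(w, z) ↦ (z - w, z)`. -/
def shear (d : ℕ) : (Phase d × Phase d) ≃L[ℝ] (Phase d × Phase d) :=
  ContinuousLinearEquiv.equivOfInverse
    ((ContinuousLinearMap.snd ℝ (Phase d) (Phase d) -
      ContinuousLinearMap.fst ℝ (Phase d) (Phase d)).prod (ContinuousLinearMap.snd ℝ _ _))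
    ((ContinuousLinearMap.snd ℝ (Phase d) (Phase d) -
      ContinuousLinearMap.fst ℝ (Phase d) (Phase d)).prod (ContinuousLinearMap.snd ℝ _ _))
    (fun x => by ext <;> simp) (fun x => by ext <;> simp)

/-- The operator `ψ ↦ (w ↦ ∫ φ (z - w) * ψ z dz)` on Schwartz functions. -/
def correlation (φ : 𝓢(Phase d, ℂ)) : 𝓢(Phase d, ℂ) →L[ℂ] 𝓢(Phase d, ℂ) :=
  integrateSndProd.comp ((compCLMOfContinuousLinearEquiv ℂ (shear d)).comp (tensorRight φ))

theorem correlation_apply (φ ψ : 𝓢(Phase d, ℂ)) (w : Phase d) :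
    correlation φ ψ w = ∫ z, φ (z - w) * ψ z := by
  simp only [correlation, ContinuousLinearMap.comp_apply]
  rw [integrateSndProd_apply, tensorRight_eq]
  rfl

/-- The convolution `a * φ` of a tempered distribution with a Schwartz function:
`⟨a * φ, ψ⟩ = ⟨a, w ↦ ∫ φ (z - w) ψ z dz⟩`. -/
def convDistrib (a : 𝓢'(Phase d, ℂ)) (φ : 𝓢(Phase d, ℂ)) : 𝓢'(Phase d, ℂ) :=
  PointwiseConvergenceCLM.precomp ℂ (correlation φ) a

/-! ### Weyl quantization -/

/-- The linear change of variables `(p, q) ↦ (-q + p / 2, -q - p / 2)`, with inverse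
`(t, x) ↦ (t - x, -(t + x) / 2)`; both have Jacobian of absolute value one. -/
def kernelCoords (d : ℕ) : Phase d ≃L[ℝ] Phase d :=
  ContinuousLinearEquiv.equivOfInverse
    ((-ContinuousLinearMap.snd ℝ (Rn d) (Rn d) +
        (2⁻¹ : ℝ) • ContinuousLinearMap.fst ℝ (Rn d) (Rn d)).prod
      (-ContinuousLinearMap.snd ℝ (Rn d) (Rn d) -
        (2⁻¹ : ℝ) • ContinuousLinearMap.fst ℝ (Rn d) (Rn d)))
    ((ContinuousLinearMap.fst ℝ (Rn d) (Rn d) - ContinuousLinearMap.snd ℝ (Rn d) (Rn d)).prod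
      (-(2⁻¹ : ℝ) • (ContinuousLinearMap.fst ℝ (Rn d) (Rn d) +
        ContinuousLinearMap.snd ℝ (Rn d) (Rn d))))
    (fun z => by
      ext i <;> simp <;> ring)
    (fun z => by
      ext i <;> simp <;> ring)

/-- The partial Fourier transform (in the second variable `ξ`) of a tempered distribution. -/
def partialFourierDistrib (u : 𝓢'(Phase d, ℂ)) : 𝓢'(Phase d, ℂ) :=
  PointwiseConvergenceCLM.precomp ℂ partialFourier u

/-- The distribution `k_u (t, x) = (F^ξ u) (t - x, -(t + x) / 2)` on `ℝ^d × ℝ^d`, that is, the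
Schwartz kernel of `ρ(u) = ∫ u(z) ρ(z) dz`, where
`[ρ(x, ξ) g] (t) = exp (-π i x · ξ + 2 π i t · ξ) g (t - x)`. -/
def rhoKernel (u : 𝓢'(Phase d, ℂ)) : 𝓢'(Phase d, ℂ) :=
  PointwiseConvergenceCLM.precomp ℂ (compCLMOfContinuousLinearEquiv ℂ (kernelCoords d))
    (partialFourierDistrib u)

/-- The operator `ρ(u)` from Schwartz functions to tempered distributions:
`⟨ρ(u) ψ, χ⟩ = ⟨k_u, χ ⊗ ψ⟩`. -/
def rho (u : 𝓢'(Phase d, ℂ)) : 𝓢(Rn d, ℂ) →L[ℂ] 𝓢'(Rn d, ℂ) where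
  toFun ψ := PointwiseConvergenceCLM.precomp ℂ (tensorLeft ψ) (rhoKernel u)
  map_add' ψ ψ' := by
    ext χ
    change rhoKernel u (tensorLeft (ψ + ψ') χ) =
      rhoKernel u (tensorLeft ψ χ) + rhoKernel u (tensorLeft ψ' χ)
    simp only [← tensorRight_eq, map_add]
  map_smul' c ψ := by
    ext χ
    change rhoKernel u (tensorLeft (c • ψ) χ) = c • rhoKernel u (tensorLeft ψ χ)
    simp only [← tensorRight_eq, map_smul]
  cont := by
    refine PointwiseConvergenceCLM.continuous_of_continuous_eval fun χ => ?_
    change Continuous fun ψ => rhoKernel u (tensorLeft ψ χ)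
    simp only [← tensorRight_eq]
    exact (rhoKernel u).continuous.comp (tensorRight χ).continuous

/-- The Weyl quantization `L_a = ρ(F_σ a)` of a tempered distribution `a`. -/
def weyl (a : 𝓢'(Phase d, ℂ)) : 𝓢(Rn d, ℂ) →L[ℂ] 𝓢'(Rn d, ℂ) :=
  rho (symplecticFourierDistrib a)

/-- The Hilbert space `L²(ℝ^d)`. -/
abbrev L2 (d : ℕ) : Type := Lp ℂ 2 (volume : Measure (Rn d))

/-- `A` maps Schwartz functions into `L²`, boundedly for the `L²` norm, and the bounded operator `T`
is its extension to `L²`. Since Schwartz functions are dense in `L²`, there is at most one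
such `T`. -/
def IsL2Extension (A : 𝓢(Rn d, ℂ) →L[ℂ] 𝓢'(Rn d, ℂ)) (T : L2 d →L[ℂ] L2 d) : Prop :=
  ∀ ψ : 𝓢(Rn d, ℂ), Lp.toTemperedDistribution (T (ψ.toLp 2 volume)) = A ψ

/-! ### Schatten classes -/

section Schatten

variable {H : Type} [NormedAddCommGroup H] [InnerProductSpace ℂ H] [CompleteSpace H]

/-- The trace `∑ ⟪e_i, S e_i⟫ ∈ [0, ∞]` of a positive operator `S`. The sum is the same for all
orthonormal bases `(e_i)`; taking the supremum over them avoids choosing one. -/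
def posTrace (S : H →L[ℂ] H) : ℝ≥0∞ :=
  ⨆ (s : Set H) (e : HilbertBasis s ℂ H), ∑' i, ENNReal.ofReal (RCLike.re ⟪e i, S (e i)⟫_ℂ)

/-- The Schatten norm: `(tr |T|^p)^{1/p}` for `p < ∞`, and the operator norm for `p = ∞`. -/
def schattenNorm (p : ℝ≥0∞) (T : H →L[ℂ] H) : ℝ≥0∞ :=
  if p = ⊤ then ‖T‖ₑ else posTrace ((CFC.abs T) ^ p.toReal) ^ (1 / p.toReal)

/-- The Schatten class `S^p`: the compact operators with finite Schatten norm for `p < ∞`, and all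
bounded operators for `p = ∞`. -/
def MemSchatten (p : ℝ≥0∞) (T : H →L[ℂ] H) : Prop :=
  (p ≠ ⊤ → IsCompactOperator T) ∧ schattenNorm p T < ⊤

end Schatten

/-! ### Weighted Sobolev norms -/

/-- The standard basis vector of phase space in the direction of `x_j` (`Sum.inl j`) or of `ξ_j`
(`Sum.inr j`). -/
def phaseBasis (d : ℕ) : Fin d ⊕ Fin d → Phase d
  | Sum.inl j => (EuclideanSpace.single j 1, 0)
  | Sum.inr j => (0, EuclideanSpace.single j 1)

/-- The coordinate `x_j` or `ξ_j` of a point of phase space. -/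
def phaseCoord (z : Phase d) : Fin d ⊕ Fin d → ℝ
  | Sum.inl j => z.1 j
  | Sum.inr j => z.2 j

/-- The monomial `z^β`. -/
def monomialFun (β : Fin d ⊕ Fin d → ℕ) (z : Phase d) : ℝ := ∏ i, phaseCoord z i ^ β i

/-- The list of all coordinate directions of phase space. -/
def phaseIndices (d : ℕ) : List (Fin d ⊕ Fin d) :=
  (List.finRange d).map Sum.inl ++ (List.finRange d).map Sum.inr

/-- The partial derivative `∂^α F`. -/
def multiDeriv (α : Fin d ⊕ Fin d → ℕ) (F : Phase d → ℂ) : Phase d → ℂ :=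
  (phaseIndices d).foldr
    (fun i G => (fun (f : Phase d → ℂ) z => lineDeriv ℝ f z (phaseBasis d i))^[α i] G) F

/-- The pairs of multi-indices `(α, β)` with `|α| + |β| ≤ N`. -/
def multiIndexPairs (d N : ℕ) : Finset ((Fin d ⊕ Fin d → ℕ) × (Fin d ⊕ Fin d → ℕ)) :=
  (Fintype.piFinset (fun _ => Finset.range (N + 1)) ×ˢ
    Fintype.piFinset (fun _ => Finset.range (N + 1))).filter
    fun γ => ∑ i, γ.1 i + ∑ i, γ.2 i ≤ N

/-- The norm `‖F‖_{(N,2)} = ∑_{|α| + |β| ≤ N} ‖∂^α (z^β F)‖_{L²}`. -/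
def weightedNorm (N : ℕ) (F : 𝓢(Phase d, ℂ)) : ℝ≥0∞ :=
  ∑ γ ∈ multiIndexPairs d N,
    eLpNorm (multiDeriv γ.1 (fun z => (monomialFun γ.2 z : ℂ) * F z)) 2 volume

theorem mem_multiIndexPairs {N : ℕ} (γ : (Fin d ⊕ Fin d → ℕ) × (Fin d ⊕ Fin d → ℕ)) :
    γ ∈ multiIndexPairs d N ↔ ∑ i, γ.1 i + ∑ i, γ.2 i ≤ N := by
  simp only [multiIndexPairs, Finset.mem_filter, Finset.mem_product, Fintype.mem_piFinset,
    Finset.mem_range, and_iff_right_iff_imp]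
  intro h
  refine ⟨fun i => ?_, fun i => ?_⟩
  · have := Finset.single_le_sum (f := γ.1) (fun _ _ => Nat.zero_le _) (Finset.mem_univ i)
    omega
  · have := Finset.single_le_sum (f := γ.2) (fun _ _ => Nat.zero_le _) (Finset.mem_univ i)
    omega

end WeylCalc

end

/-! Write `π(w)` for the time-frequency shift by `w = (y, ω)` and `Φ` for the symplectic Fourier
transform of `φ`. Since that transform turns convolution into multiplication, and multiplication of
the twisted symbol by a character conjugates the operator by a shift, the quantization of `a * φ` is
weakly the superposition `∫ a(w) π(w) L_φ π(w)* dw`. The theorem follows once `L_φ` is decomposed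
into rank-one operators whose norms are summable.

Decomposition: let `k(x, t)` be the kernel of `L_φ`, and let `K(x, τ)` be the Fourier transform in
`t` of `(1 + |t|²)^d k(x, t)`. Fourier inversion gives `L_φ = ∫ |u_τ⟩⟨v_τ| dτ`, where `u_τ(t) =
e^{2πi t·τ} (1 + |t|²)^{-d}` has a norm `D` independent of `τ`, and `v_τ` is the conjugate of `K(·,
τ)` (`toKernelOp_eq`, `weyl_separated`). Hence `M_a = ∫∫ a(w) |π(w) u_τ⟩⟨π(w) v_τ| dw dτ`.

Schatten bound: two Bessel inequalities are played against each other. Shifts satisfy `∫ |⟨π(w) u,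
f⟩|² dw ≤ ‖u‖² ‖f‖²`, and orthonormal families satisfy the usual one. With Hölder's inequality they
bound `∑ |⟨f_k, M_a e_k⟩|^p` over all finite orthonormal families by `(∫ ‖u_τ‖ ‖v_τ‖ dτ · ‖a‖_p)^p`,
without interpolation (`BesselFamily.sum_rpow_le`). Such a bound forces compactness and controls `tr
|T|^p` (`OrthoSumLE.isCompactOperator`, `OrthoSumLE.posTrace_le`).

Dependence on `φ`: Cauchy–Schwarz gives `∫ ‖v_τ‖ dτ ≤ D ‖(1 + |τ|²)^d K‖_2`. Both weights pull back
through the passage from symbols to kernels to differential operators with polynomial coefficients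
acting on `Φ`, of total order `4d`. The remaining maps do not increase the `L²` norm, and normal
ordering yields the weighted Sobolev norm (`bracketOp_weightedKernel`,
`exists_weightedKernel_bound`). -/

noncomputable section
namespace WeylCalc

/-! ### Schatten classes and orthonormal families -/

section SchattenCriterion

variable {H : Type} [NormedAddCommGroup H] [InnerProductSpace ℂ H] [CompleteSpace H]

/-- Every sum `∑ |⟪f k, T (e k)⟫| ^ p` over finite orthonormal families is at most `K`. -/
def OrthoSumLE (T : H →L[ℂ] H) (p : ℝ) (K : ℝ≥0∞) : Prop :=
  ∀ (n : ℕ) (e f : Fin n → H), Orthonormal ℂ e → Orthonormal ℂ f →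
    ∑ k, ‖⟪f k, T (e k)⟫_ℂ‖ₑ ^ p ≤ K

lemma orthonormal_cons {n : ℕ} {e : Fin n → H} (he : Orthonormal ℂ e) {x : H} (hx : ‖x‖ = 1)
    (hxe : ∀ k, ⟪e k, x⟫_ℂ = 0) : Orthonormal ℂ (Fin.cons x e : Fin (n + 1) → H) := by
  refine ⟨fun i => ?_, fun i j hij => ?_⟩
  · refine Fin.cases ?_ (fun k => ?_) i
    · simpa using hx
    · simpa using he.1 k
  · induction i using Fin.cases with
    | zero =>
      induction j using Fin.cases with
      | zero => exact absurd rfl hij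
      | succ j => simpa using inner_eq_zero_symm.1 (hxe j)
    | succ i =>
      induction j using Fin.cases with
      | zero => simpa using hxe i
      | succ j => simpa using he.2 (fun h => hij (congrArg Fin.succ h))

lemma isCompactOperator_starProjection (P : Submodule ℂ H) [FiniteDimensional ℂ P] :
    IsCompactOperator (P.starProjection : H →L[ℂ] H) := by
  have h : IsCompactOperator (P.subtypeL : P →L[ℂ] H) := by
    have : ProperSpace P := FiniteDimensional.proper ℂ P
    exact isCompactOperator_of_locallyCompactSpace_rng P.subtypeL
  exact h.comp_clm P.orthogonalProjectionOnto

/-- Orthonormal families with all `|⟪f k, T (e k)⟫| ≥ δ` have length at most `K / δ ^ p`, so a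
longest pair exists. Its spans serve as `P` and `Q`: a pair `x`, `y` orthogonal to them and
violating the bound would, once normalized, extend the families. -/
lemma exists_finite_projections {T : H →L[ℂ] H} {p : ℝ} (hp : 0 < p) {K : ℝ≥0∞} (hK : K ≠ ⊤)
    (h : OrthoSumLE T p K) {δ : ℝ} (hδ : 0 < δ) :
    ∃ P Q : Submodule ℂ H, FiniteDimensional ℂ P ∧ FiniteDimensional ℂ Q ∧
      ∀ x ∈ Pᗮ, ∀ y ∈ Qᗮ, ‖⟪y, T x⟫_ℂ‖ ≤ δ * (‖x‖ * ‖y‖) := by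
  classical
  let good : ℕ → Prop := fun n => ∃ e f : Fin n → H, Orthonormal ℂ e ∧ Orthonormal ℂ f ∧
    ∀ k, δ ≤ ‖⟪f k, T (e k)⟫_ℂ‖
  have hc : (ENNReal.ofReal δ) ^ p ≠ 0 := by
    simp [ENNReal.rpow_eq_zero_iff, hδ, hp]
  have hbound : ∀ n, good n → (n : ℝ≥0∞) ≤ K / (ENNReal.ofReal δ) ^ p := by
    rintro n ⟨e, f, he, hf, hef⟩
    rw [ENNReal.le_div_iff_mul_le (Or.inl hc) (Or.inr hK)]
    refine le_trans ?_ (h n e f he hf)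
    calc (n : ℝ≥0∞) * ENNReal.ofReal δ ^ p = ∑ _k : Fin n, ENNReal.ofReal δ ^ p := by simp
      _ ≤ _ := by
        gcongr with k
        rw [← ofReal_norm]
        exact ENNReal.ofReal_le_ofReal (hef k)
  have hfin : K / (ENNReal.ofReal δ) ^ p ≠ ⊤ := ENNReal.div_ne_top hK hc
  obtain ⟨m, hm⟩ := ENNReal.exists_nat_gt hfin
  have hlt : ∀ n, good n → n ≤ m := fun n hn => by
    have := (hbound n hn).trans hm.le
    exact_mod_cast this
  have h0 : good 0 := ⟨Fin.elim0, Fin.elim0, ⟨fun i => i.elim0, fun i => i.elim0⟩,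
    ⟨fun i => i.elim0, fun i => i.elim0⟩, fun i => i.elim0⟩
  have hmax := Nat.findGreatest_spec (P := good) (Nat.zero_le m) h0
  set n := Nat.findGreatest good m
  obtain ⟨e, f, he, hf, hef⟩ := hmax
  refine ⟨Submodule.span ℂ (Set.range e), Submodule.span ℂ (Set.range f),
    FiniteDimensional.span_of_finite ℂ (Set.finite_range e),
    FiniteDimensional.span_of_finite ℂ (Set.finite_range f), fun x hx y hy => ?_⟩
  by_contra hcon
  push Not at hcon
  have hx0 : x ≠ 0 := by rintro rfl; simp at hcon
  have hy0 : y ≠ 0 := by rintro rfl; simp at hcon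
  have hxn := norm_pos_iff.2 hx0
  have hyn := norm_pos_iff.2 hy0
  have hgood : good (n + 1) := by
    refine ⟨Fin.cons ((‖x‖⁻¹ : ℂ) • x) e, Fin.cons ((‖y‖⁻¹ : ℂ) • y) f,
      orthonormal_cons he ?_ fun k => ?_, orthonormal_cons hf ?_ fun k => ?_, fun k => ?_⟩
    · exact norm_smul_inv_norm hx0
    · rw [inner_smul_right, (Submodule.mem_orthogonal _ x).1 hx (e k)
        (Submodule.subset_span ⟨k, rfl⟩), mul_zero]
    · exact norm_smul_inv_norm hy0
    · rw [inner_smul_right, (Submodule.mem_orthogonal _ y).1 hy (f k)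
        (Submodule.subset_span ⟨k, rfl⟩), mul_zero]
    · refine Fin.cases ?_ (fun k => ?_) k
      · simp only [Fin.cons_zero, map_smul, inner_smul_left, inner_smul_right, norm_mul]
        simp only [map_inv₀, norm_inv, RCLike.norm_conj, Complex.norm_real, norm_norm]
        have := hcon.le
        rw [← mul_assoc, ← mul_inv, inv_mul_eq_div, le_div_iff₀ (by positivity)]
        exact this
      · simpa using hef k
  have := Nat.le_findGreatest (hlt _ hgood) hgood
  omega

/-- The form bound is tested at `x' = Pᗮ x` and `y = Qᗮ T x'`, for which `⟪y, T x'⟫ = ‖y‖ ^ 2`. -/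
lemma norm_compress_le (T : H →L[ℂ] H) (P Q : Submodule ℂ H) [FiniteDimensional ℂ P]
    [FiniteDimensional ℂ Q] {δ : ℝ} (hδ : 0 ≤ δ)
    (h : ∀ x ∈ Pᗮ, ∀ y ∈ Qᗮ, ‖⟪y, T x⟫_ℂ‖ ≤ δ * (‖x‖ * ‖y‖)) :
    ‖Qᗮ.starProjection * T * Pᗮ.starProjection‖ ≤ δ := by
  refine ContinuousLinearMap.opNorm_le_bound _ hδ fun x => ?_
  have hxn := Pᗮ.norm_starProjection_apply_le x
  have hx := Submodule.starProjection_apply_mem Pᗮ x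
  change ‖Qᗮ.starProjection (T (Pᗮ.starProjection x))‖ ≤ _
  set x' := Pᗮ.starProjection x
  have hy := Submodule.starProjection_apply_mem Qᗮ (T x')
  have h2 : ⟪Qᗮ.starProjection (T x'), T x'⟫_ℂ = (‖Qᗮ.starProjection (T x')‖ : ℂ) ^ 2 := by
    refine Eq.trans ?_ (inner_self_eq_norm_sq_to_K (𝕜 := ℂ) (Qᗮ.starProjection (T x')))
    rw [Submodule.inner_starProjection_left_eq_right, Submodule.inner_starProjection_left_eq_right,
      Submodule.starProjection_eq_self_iff.2 hy]
  have h3 := h x' hx _ hy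
  set y := Qᗮ.starProjection (T x')
  rw [h2, norm_pow, Complex.norm_real, norm_norm] at h3
  rcases (norm_nonneg y).eq_or_lt with h0 | h0
  · rw [← h0]; positivity
  · have h4 : ‖y‖ ≤ δ * ‖x'‖ := by
      refine le_of_mul_le_mul_right ?_ h0
      linarith [pow_two ‖y‖]
    exact h4.trans (by gcongr)

/-- `T` differs from the small compression `Qᗮ T Pᗮ` by `Q T Pᗮ + T P`, which has finite rank. So
`T` is a norm limit of compact operators. -/
theorem OrthoSumLE.isCompactOperator {T : H →L[ℂ] H} {p : ℝ} (hp : 0 < p) {K : ℝ≥0∞}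
    (hK : K ≠ ⊤) (h : OrthoSumLE T p K) : IsCompactOperator T := by
  have hcl := isClosed_setOfPred_isCompactOperator (𝕜₁ := ℂ) (𝕜₂ := ℂ) (σ₁₂ := RingHom.id ℂ)
    (M₁ := H) (M₂ := H)
  refine hcl.closure_subset (Metric.mem_closure_iff.2 fun ε hε => ?_)
  obtain ⟨P, Q, hP, hQ, hPQ⟩ := exists_finite_projections hp hK h (half_pos hε)
  have hn := norm_compress_le T P Q (half_pos hε).le hPQ
  have hR : T - Qᗮ.starProjection * T * Pᗮ.starProjection =
      Q.starProjection * (T * Pᗮ.starProjection) + T * P.starProjection := by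
    rw [Submodule.starProjection_orthogonal', Submodule.starProjection_orthogonal']
    noncomm_ring
  refine ⟨T - Qᗮ.starProjection * T * Pᗮ.starProjection, ?_, ?_⟩
  · have h1 : IsCompactOperator (Q.starProjection * (T * Pᗮ.starProjection) : H →L[ℂ] H) :=
      (isCompactOperator_starProjection Q).comp_clm (T * Pᗮ.starProjection)
    have h2 : IsCompactOperator (T * P.starProjection : H →L[ℂ] H) :=
      (isCompactOperator_starProjection P).clm_comp T
    rw [hR]
    exact h1.add h2
  · rw [dist_eq_norm, sub_sub_cancel]; linarith

/-- Hilbert bases of the individual eigenspaces are glued together. The union is orthonormal because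
eigenspaces of a symmetric operator are orthogonal, and complete by the spectral theorem for compact
symmetric operators. -/
lemma exists_hilbertBasis_eigenvectors {A : H →L[ℂ] H} (hA : IsCompactOperator A)
    (hsym : A.IsSymmetric) : ∃ (ι : Type) (b : HilbertBasis ι ℂ H) (μ : ι → ℂ),
      ∀ i, A (b i) = μ i • b i := by
  let E : ℂ → Submodule ℂ H := fun μ => Module.End.eigenspace (A : Module.End ℂ H) μ
  have hcl : ∀ μ, IsClosed (E μ : Set H) := fun μ => by
    have : (E μ : Set H) = {x | A x = μ • x} := by
      ext x; exact Module.End.mem_eigenspace_iff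
    rw [this]
    exact isClosed_eq A.continuous (continuous_const_smul μ)
  have hcomp : ∀ μ, CompleteSpace (E μ) := fun μ => (hcl μ).completeSpace_coe
  choose w b hb using fun μ => exists_hilbertBasis ℂ (E μ)
  have horth := hsym.orthogonalFamily_eigenspaces
  have hon : Orthonormal ℂ (fun a : Σ μ, w μ => ((b a.1 a.2 : E a.1) : H)) :=
    horth.orthonormal_sigma_orthonormal fun μ => (b μ).orthonormal
  refine ⟨Σ μ, w μ, HilbertBasis.mkOfOrthogonalEqBot hon ?_, fun a => a.1, fun a => ?_⟩
  · rw [← A.orthogonalComplement_iSup_eigenspaces_eq_bot hA hsym]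
    refine le_antisymm ?_ (Submodule.orthogonal_le ?_)
    -- A vector orthogonal to every basis vector is orthogonal to each eigenvector, by expanding the
    -- latter in the basis of its own eigenspace.
    · intro x hx
      rw [← Submodule.iInf_orthogonal, Submodule.mem_iInf]
      refine fun μ => (Submodule.mem_orthogonal' _ x).2 fun z hz => ?_
      have hs := (b μ).hasSum_repr ⟨z, hz⟩
      have hs' := hs.mapL ((innerSL ℂ x).comp (E μ).subtypeL)
      refine hs'.unique (HasSum.congr_fun hasSum_zero fun i => ?_) |>.trans rfl
      simp only [map_smul, ContinuousLinearMap.comp_apply, Submodule.subtypeL_apply]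
      rw [innerSL_apply_apply, (Submodule.mem_orthogonal' _ x).1 hx _
        (Submodule.subset_span ⟨⟨μ, i⟩, rfl⟩), smul_zero]
    · rw [Submodule.span_le]
      rintro _ ⟨a, rfl⟩
      exact Submodule.mem_iSup_of_mem a.1 (b a.1 a.2).2
  · rw [HilbertBasis.coe_mkOfOrthogonalEqBot]
    exact Module.End.mem_eigenspace_iff.1 (b a.1 a.2).2

lemma mem_spectrum_of_eigenvector {A : H →L[ℂ] H} {μ : ℝ} {x : H} (hx : A x = (μ : ℂ) • x)
    (hx0 : x ≠ 0) : μ ∈ spectrum ℝ A := by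
  rw [spectrum.mem_iff]
  rintro ⟨u, hu⟩
  have h1 : (u : H →L[ℂ] H) x = 0 := by
    rw [hu]
    change (algebraMap ℝ (H →L[ℂ] H) μ) x - A x = 0
    rw [hx, Algebra.algebraMap_eq_smul_one]
    simp
  have h2 : ((u⁻¹ : (H →L[ℂ] H)ˣ) * u : H →L[ℂ] H) x = 0 := by
    change ((u⁻¹ : (H →L[ℂ] H)ˣ) : H →L[ℂ] H) ((u : H →L[ℂ] H) x) = 0
    rw [h1, map_zero]
  rw [Units.inv_mul] at h2
  exact hx0 h2

/-- The identity holds for constants and for the coordinate function, is stable under sums and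
products, and is closed under uniform limits on the spectrum. Stone–Weierstrass then gives it for
all continuous functions. -/
lemma cfc_apply_eigenvector {A : H →L[ℂ] H} (hA : IsSelfAdjoint A) {μ : ℝ} {x : H}
    (hx : A x = (μ : ℂ) • x) (f : ℝ → ℝ) (hf : Continuous f) :
    cfc f A x = (f μ : ℂ) • x := by
  rcases eq_or_ne x 0 with rfl | hx0
  · simp
  have hμ := mem_spectrum_of_eigenvector hx hx0
  rw [cfc_apply f A hA hf.continuousOn]
  have key : ∀ g : C(spectrum ℝ A, ℝ), cfcHom hA g x = (g ⟨μ, hμ⟩ : ℂ) • x := by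
    intro g
    have : CompactSpace (spectrum ℝ A) := isCompact_iff_compactSpace.1 (spectrum.isCompact A)
    have hid : cfcHom hA (ContinuousMap.restrict (spectrum ℝ A) (.id ℝ)) x = (μ : ℂ) • x := by
      rw [cfcHom_id hA, hx]
    induction g using ContinuousMap.induction_on_of_compact with
    | const r =>
      have : ContinuousMap.const (spectrum ℝ A) r = algebraMap ℝ C(spectrum ℝ A, ℝ) r := rfl
      rw [this, AlgHomClass.commutes, Algebra.algebraMap_eq_smul_one]
      simp
    | id => exact hid
    | star_id => simpa using hid
    | add f g hf hg => simp [map_add, hf, hg, add_smul]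
    | mul f g hf hg =>
      rw [map_mul]
      change cfcHom hA f (cfcHom hA g x) = _
      rw [hg, map_smul, hf, smul_smul]
      simp [mul_comm]
    | frequently f hf =>
      have hcl : IsClosed {g : C(spectrum ℝ A, ℝ) | cfcHom hA g x = (g ⟨μ, hμ⟩ : ℂ) • x} := by
        refine isClosed_eq ?_ ?_
        · exact (ContinuousLinearMap.apply ℂ H x).continuous.comp (cfcHom_continuous hA)
        · exact (Complex.continuous_ofReal.comp (continuous_eval_const _)).smul
            continuous_const
      exact hcl.closure_subset (mem_closure_iff_frequently.2 hf)
  exact key _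

/-- `|T| ^ p` is the function `s ↦ s ^ (p / 2)` of `T* T`, so the eigenvalue `r ^ 2` becomes `r ^
p`. -/
lemma abs_rpow_apply_eigenvector {T : H →L[ℂ] H} {r : ℝ} (hr : 0 ≤ r) {x : H}
    (hx : (star T * T) x = ((r ^ 2 : ℝ) : ℂ) • x) {p : ℝ} (hp : 0 < p) :
    (CFC.abs T ^ p) x = ((r ^ p : ℝ) : ℂ) • x := by
  have h0 : 0 ≤ star T * T := star_mul_self_nonneg T
  have h1 : CFC.abs T ^ p = (star T * T) ^ (p / 2) := by
    rw [CFC.abs, CFC.sqrt_eq_rpow, CFC.rpow_rpow_of_exponent_nonneg _ _ _ (by norm_num) hp.le]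
    congr 1; ring
  rw [h1, CFC.rpow_def, cfc_nnreal_eq_real _ _ h0]
  rw [cfc_apply_eigenvector (IsSelfAdjoint.of_nonneg h0) hx]
  · congr 2
    rw [Real.toNNReal_of_nonneg (by positivity)]
    simp only [NNReal.coe_rpow, NNReal.coe_mk]
    rw [← Real.rpow_natCast, ← Real.rpow_mul hr]
    congr 1; push_cast; ring
  · exact NNReal.continuous_coe.comp
      ((NNReal.continuous_rpow_const (by positivity)).comp continuous_real_toNNReal)

/-- An eigenbasis of the compact operator `T* T` has this property because its eigenvalues are
forced: `⟪b i, T* T (b i)⟫ = ‖T (b i)‖ ^ 2`. -/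
lemma exists_singular_basis {T : H →L[ℂ] H} (hT : IsCompactOperator T) :
    ∃ (ι : Type) (b : HilbertBasis ι ℂ H),
      ∀ i, (star T * T) (b i) = ((‖T (b i)‖ ^ 2 : ℝ) : ℂ) • b i := by
  have hc : IsCompactOperator (star T * T : H →L[ℂ] H) := hT.clm_comp (star T)
  have hs : (star T * T).IsSymmetric :=
    (IsSelfAdjoint.star_mul_self T).isSymmetric
  obtain ⟨ι, b, μ, hb⟩ := exists_hilbertBasis_eigenvectors hc hs
  refine ⟨ι, b, fun i => ?_⟩
  rw [hb i]
  congr 1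
  have h1 : ⟪b i, (star T * T) (b i)⟫_ℂ = μ i := by
    rw [hb i, inner_smul_right, inner_self_eq_norm_sq_to_K, b.orthonormal.1 i]; simp
  have h2 : ⟪b i, (star T * T) (b i)⟫_ℂ = ((‖T (b i)‖ ^ 2 : ℝ) : ℂ) := by
    change ⟪b i, star T (T (b i))⟫_ℂ = _
    rw [ContinuousLinearMap.star_eq_adjoint, ContinuousLinearMap.adjoint_inner_right,
      inner_self_eq_norm_sq_to_K]
    simp
  rw [← h1, h2]

lemma tsum_enorm_inner_sq {ι : Type} (b : HilbertBasis ι ℂ H) (x : H) :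
    ∑' i, ‖⟪b i, x⟫_ℂ‖ₑ ^ 2 = ‖x‖ₑ ^ 2 := by
  have h := b.hasSum_inner_mul_inner x x
  have h' : HasSum (fun i => ‖⟪b i, x⟫_ℂ‖ ^ 2) (‖x‖ ^ 2) := by
    have := Complex.hasSum_re h
    convert this using 1
    · funext i
      rw [← inner_conj_symm x (b i), ← Complex.normSq_eq_conj_mul_self, Complex.ofReal_re,
        Complex.normSq_eq_norm_sq]
    · rw [inner_self_eq_norm_sq_to_K]
      simp [← Complex.ofReal_pow]
  have e := ENNReal.ofReal_tsum_of_nonneg (fun i => sq_nonneg ‖⟪b i, x⟫_ℂ‖) h'.summable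
  rw [h'.tsum_eq] at e
  simpa [ENNReal.ofReal_pow, ofReal_norm] using e.symm

/-- In a singular basis `b` the images `T (b i)` are orthogonal. Testing the hypothesis on `b i` and
the normalized `T (b i)` gives `∑ ‖T (b i)‖ ^ p ≤ K`. For any other basis `c`, the trace of `|T| ^
p` is expanded along `b`; Tonelli and Parseval for `c` return the same sum. -/
theorem OrthoSumLE.posTrace_le {T : H →L[ℂ] H} {p : ℝ} (hp : 0 < p) {K : ℝ≥0∞}
    (hT : IsCompactOperator T) (h : OrthoSumLE T p K) : posTrace (CFC.abs T ^ p) ≤ K := by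
  obtain ⟨ι, b, hb⟩ := exists_singular_basis hT
  have hS : ∀ i, (CFC.abs T ^ p) (b i) = ((‖T (b i)‖ ^ p : ℝ) : ℂ) • b i := fun i =>
    abs_rpow_apply_eigenvector (norm_nonneg _) (hb i) hp
  have hinner : ∀ i j, ⟪T (b i), T (b j)⟫_ℂ = ((‖T (b i)‖ ^ 2 : ℝ) : ℂ) * ⟪b i, b j⟫_ℂ := by
    intro i j
    have : ⟪(star T * T) (b i), b j⟫_ℂ = ⟪T (b i), T (b j)⟫_ℂ := by
      change ⟪star T (T (b i)), b j⟫_ℂ = _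
      rw [ContinuousLinearMap.star_eq_adjoint, ContinuousLinearMap.adjoint_inner_left]
    rw [← this, hb i, inner_smul_left, Complex.conj_ofReal]
  have hsum : ∑' i, ‖T (b i)‖ₑ ^ p ≤ K := by
    rw [ENNReal.tsum_eq_iSup_sum]
    refine iSup_le fun s => ?_
    classical
    -- Indices with `T (b i) = 0` cannot be normalized; they contribute nothing because `p > 0`.
    let s' := s.filter fun i => T (b i) ≠ 0
    have hs : ∑ i ∈ s, ‖T (b i)‖ₑ ^ p = ∑ i ∈ s', ‖T (b i)‖ₑ ^ p := by
      refine (Finset.sum_filter_of_ne (p := fun i => T (b i) ≠ 0) fun i _ hi h0 => hi ?_).symm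
      rw [h0, enorm_zero, ENNReal.zero_rpow_of_pos hp]
    let g := s'.equivFin.symm
    have hne : ∀ k, T (b (g k)) ≠ 0 := fun k => (Finset.mem_filter.1 (g k).2).2
    have hinj : Function.Injective fun k => ((g k : s') : ι) :=
      Subtype.val_injective.comp g.injective
    have he : Orthonormal ℂ (fun k => b (g k)) := b.orthonormal.comp _ hinj
    have hf : Orthonormal ℂ (fun k => (‖T (b (g k))‖⁻¹ : ℂ) • T (b (g k))) := by
      refine ⟨fun k => norm_smul_inv_norm (hne k), fun k l hkl => ?_⟩
      have h0 : ⟪b (g k), b (g l)⟫_ℂ = 0 := he.2 hkl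
      change ⟪(‖T (b (g k))‖⁻¹ : ℂ) • T (b (g k)), (‖T (b (g l))‖⁻¹ : ℂ) • T (b (g l))⟫_ℂ = 0
      rw [inner_smul_left, inner_smul_right, hinner, h0]
      simp
    have := h _ _ _ he hf
    rw [hs, ← Finset.sum_coe_sort, ← g.sum_comp]
    refine le_of_eq_of_le (Finset.sum_congr rfl fun k _ => ?_) this
    congr 1
    rw [inner_smul_left, inner_self_eq_norm_sq_to_K, ← ofReal_norm, ← ofReal_norm]
    congr 1
    have := norm_pos_iff.2 (hne k)
    simp
    field_simp
  refine iSup_le fun w => iSup_le fun c => ?_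
  have hc : ∀ j, ENNReal.ofReal (RCLike.re ⟪c j, (CFC.abs T ^ p) (c j)⟫_ℂ) =
      ∑' i, ‖T (b i)‖ₑ ^ p * ‖⟪b i, c j⟫_ℂ‖ₑ ^ 2 := by
    intro j
    have h1 := ((b.hasSum_repr (c j)).mapL (CFC.abs T ^ p)).mapL (innerSL ℂ (c j))
    have h2 : HasSum (fun i => ‖T (b i)‖ ^ p * ‖⟪b i, c j⟫_ℂ‖ ^ 2)
        (RCLike.re ⟪c j, (CFC.abs T ^ p) (c j)⟫_ℂ) := by
      have := Complex.hasSum_re h1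
      refine HasSum.congr_fun this fun i => ?_
      rw [map_smul, map_smul, hS, map_smul, innerSL_apply_apply, b.repr_apply_apply, smul_eq_mul,
        smul_eq_mul, mul_left_comm, ← inner_conj_symm (c j) (b i), Complex.mul_conj,
        ← Complex.ofReal_mul, Complex.ofReal_re, Complex.normSq_eq_norm_sq]
    rw [← h2.tsum_eq, ENNReal.ofReal_tsum_of_nonneg (fun i => by positivity) h2.summable]
    refine tsum_congr fun i => ?_
    rw [ENNReal.ofReal_mul (by positivity), ENNReal.ofReal_pow (norm_nonneg _),
      ← ENNReal.ofReal_rpow_of_nonneg (norm_nonneg _) hp.le, ofReal_norm, ofReal_norm]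
  simp only [hc]
  rw [ENNReal.tsum_comm]
  refine le_trans (ENNReal.tsum_le_tsum fun i => ?_) hsum
  rw [ENNReal.tsum_mul_left]
  refine mul_le_of_le_one_right zero_le ?_
  have : ∀ j, ‖⟪b i, c j⟫_ℂ‖ₑ ^ 2 = ‖⟪c j, b i⟫_ℂ‖ₑ ^ 2 := fun j => by
    rw [← inner_conj_symm, ← ofReal_norm, ← ofReal_norm, RCLike.norm_conj]
  simp only [this]
  rw [tsum_enorm_inner_sq c (b i), ← ofReal_norm, b.orthonormal.1 i]
  simp

lemma enorm_le_of_inner_le {T : H →L[ℂ] H} {K : ℝ≥0∞}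
    (h : ∀ x y, ‖⟪y, T x⟫_ℂ‖ₑ ≤ K * (‖x‖ₑ * ‖y‖ₑ)) : ‖T‖ₑ ≤ K := by
  rcases eq_or_ne K ⊤ with rfl | hK
  · exact le_top
  lift K to NNReal using hK
  have : ‖T‖ ≤ K := by
    refine ContinuousLinearMap.opNorm_le_bound _ K.2 fun x => ?_
    have h1 := h x (T x)
    simp only [enorm_eq_nnnorm, ← ENNReal.coe_mul, ENNReal.coe_le_coe] at h1
    have h2 : ‖⟪T x, T x⟫_ℂ‖ ≤ K * (‖x‖ * ‖T x‖) := by exact_mod_cast h1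
    rw [inner_self_eq_norm_sq_to_K, norm_pow] at h2
    simp only [RCLike.norm_ofReal, abs_norm] at h2
    rcases (norm_nonneg (T x)).eq_or_lt with h0 | h0
    · rw [← h0]; positivity
    · refine le_of_mul_le_mul_right ?_ h0
      linarith [pow_two ‖T x‖]
  rw [enorm_eq_nnnorm]
  exact_mod_cast this

end SchattenCriterion

end WeylCalc
end
noncomputable section
namespace WeylCalc

/-! ### Superpositions of rank-one operators -/

section Superposition

variable {H : Type} [NormedAddCommGroup H] [InnerProductSpace ℂ H] [CompleteSpace H]

/-- Hölder's inequality for `A` and `1` with respect to the measure `c dμ`, realized by splitting `c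
= c ^ (1 / p) * c ^ (1 / q)`. -/
lemma lintegral_mul_rpow_le {Ω : Type} [MeasurableSpace Ω] (μ : Measure Ω) {p : ℝ} (hp : 1 ≤ p)
    {A c : Ω → ℝ≥0∞} (hA : AEMeasurable A μ) (hc : AEMeasurable c μ) :
    (∫⁻ x, A x * c x ∂μ) ^ p ≤ (∫⁻ x, A x ^ p * c x ∂μ) * (∫⁻ x, c x ∂μ) ^ (p - 1) := by
  rcases hp.eq_or_lt with rfl | hp1
  · simp
  have hpq := Real.HolderConjugate.conjExponent hp1
  set q := Real.conjExponent p
  have hp0 : 0 < p := hpq.pos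
  have h := ENNReal.lintegral_mul_le_Lp_mul_Lq μ hpq (f := fun x => A x * c x ^ (1 / p))
    (g := fun x => c x ^ (1 / q)) (hA.mul (hc.pow_const _)) (hc.pow_const _)
  have e1 : ∀ x, c x ^ (1 / p) * c x ^ (1 / q) = c x := fun x => by
    rw [← ENNReal.rpow_add_of_nonneg _ _ (by positivity) (by have := hpq.symm.pos; positivity),
      one_div, one_div, hpq.inv_add_inv_eq_one, ENNReal.rpow_one]
  simp only [Pi.mul_apply, mul_assoc, e1] at h
  have e2 : ∀ x, (A x * c x ^ (1 / p)) ^ p = A x ^ p * c x := fun x => by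
    rw [ENNReal.mul_rpow_of_nonneg _ _ hp0.le, ← ENNReal.rpow_mul, one_div_mul_cancel hp0.ne',
      ENNReal.rpow_one]
  have e3 : ∀ x, (c x ^ (1 / q)) ^ q = c x := fun x => by
    rw [← ENNReal.rpow_mul, one_div_mul_cancel hpq.symm.ne_zero, ENNReal.rpow_one]
  simp only [e2, e3] at h
  refine (ENNReal.rpow_le_rpow h hp0.le).trans_eq ?_
  rw [ENNReal.mul_rpow_of_nonneg _ _ hp0.le, ← ENNReal.rpow_mul, ← ENNReal.rpow_mul,
    one_div_mul_cancel hp0.ne', ENNReal.rpow_one]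
  congr 2
  have := hpq.sub_one_mul_conj
  have hq := hpq.symm.ne_zero
  field_simp
  linarith

lemma enorm_inner_le (x y : H) : ‖⟪x, y⟫_ℂ‖ₑ ≤ ‖x‖ₑ * ‖y‖ₑ := by
  rw [← ofReal_norm, ← ofReal_norm, ← ofReal_norm, ← ENNReal.ofReal_mul (norm_nonneg _)]
  exact ENNReal.ofReal_le_ofReal (norm_inner_le_norm x y)

lemma enorm_inner_symm (x y : H) : ‖⟪x, y⟫_ℂ‖ₑ = ‖⟪y, x⟫_ℂ‖ₑ := by
  rw [← ofReal_norm, ← ofReal_norm, norm_inner_symm]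

/-- Cauchy–Schwarz over `k`, followed by Bessel's inequality for each of the two families. -/
lemma sum_enorm_inner_mul_le {n : ℕ} {e f : Fin n → H} (he : Orthonormal ℂ e)
    (hf : Orthonormal ℂ f) (u v : H) :
    ∑ k, ‖⟪u, f k⟫_ℂ‖ₑ * ‖⟪v, e k⟫_ℂ‖ₑ ≤ ‖u‖ₑ * ‖v‖ₑ := by
  have bessel : ∀ {e : Fin n → H}, Orthonormal ℂ e → ∀ v : H,
      √(∑ k, ‖⟪v, e k⟫_ℂ‖ ^ 2) ≤ ‖v‖ := fun he v => by
    refine Real.sqrt_le_iff.2 ⟨norm_nonneg _, ?_⟩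
    simpa only [norm_inner_symm v] using he.sum_inner_products_le v (s := Finset.univ)
  have h : ∑ k, ‖⟪u, f k⟫_ℂ‖ * ‖⟪v, e k⟫_ℂ‖ ≤ ‖u‖ * ‖v‖ := by
    refine (Real.sum_mul_le_sqrt_mul_sqrt _ _ _).trans ?_
    gcongr
    · exact bessel hf u
    · exact bessel he v
  have h' := ENNReal.ofReal_le_ofReal h
  rw [ENNReal.ofReal_sum_of_nonneg (fun _ _ => by positivity)] at h'
  simpa only [ENNReal.ofReal_mul (norm_nonneg _), ofReal_norm] using h'

variable {Y X : Type} [MeasurableSpace Y] [MeasurableSpace X]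

/-- A family `u τ w` of vectors, with `‖u τ w‖ ≤ U τ`, whose members for fixed `τ` satisfy the
Bessel inequality `∫ |⟪u τ w, f⟫|² dw ≤ U τ ² ‖f‖²`. -/
structure BesselFamily (μ : Measure X) (u : Y → X → H) (U : Y → ℝ≥0∞) : Prop where
  norm_le : ∀ τ w, ‖u τ w‖ₑ ≤ U τ
  bessel : ∀ τ f, ∫⁻ w, ‖⟪u τ w, f⟫_ℂ‖ₑ ^ (2 : ℝ) ∂μ ≤ (U τ * ‖f‖ₑ) ^ (2 : ℝ)
  measurable : ∀ f, Measurable fun q : Y × X => ⟪u q.1 q.2, f⟫_ℂ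
  measurable_bound : Measurable U

namespace BesselFamily

variable {ν : Measure Y} {μ : Measure X} [SFinite ν] [SFinite μ]
  {u v : Y → X → H} {U V : Y → ℝ≥0∞}

lemma measurable_mul (hu : BesselFamily μ u U) (hv : BesselFamily μ v V) (f e : H) :
    Measurable fun q : Y × X => ‖⟪u q.1 q.2, f⟫_ℂ‖ₑ * ‖⟪v q.1 q.2, e⟫_ℂ‖ₑ :=
  (hu.measurable f).enorm.mul (hv.measurable e).enorm

lemma measurable_mul_bound (hu : BesselFamily μ u U) (hv : BesselFamily μ v V) :
    Measurable fun τ => U τ * V τ :=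
  hu.measurable_bound.mul hv.measurable_bound

/-- For fixed `τ`, Cauchy–Schwarz in `w` and the two Bessel inequalities give `U τ * V τ * ‖f‖ *
‖e‖`; it remains to integrate over `τ`. -/
lemma lintegral_mul_le (hu : BesselFamily μ u U) (hv : BesselFamily μ v V) (f e : H) :
    ∫⁻ q, ‖⟪u q.1 q.2, f⟫_ℂ‖ₑ * ‖⟪v q.1 q.2, e⟫_ℂ‖ₑ ∂ν.prod μ ≤
      (∫⁻ τ, U τ * V τ ∂ν) * (‖f‖ₑ * ‖e‖ₑ) := by
  rw [lintegral_prod _ (hu.measurable_mul hv f e).aemeasurable,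
    ← lintegral_mul_const _ (hu.measurable_mul_bound hv)]
  refine lintegral_mono fun τ => ?_
  have m1 : Measurable fun w => ‖⟪u τ w, f⟫_ℂ‖ₑ :=
    ((hu.measurable f).comp measurable_prodMk_left).enorm
  have m2 : Measurable fun w => ‖⟪v τ w, e⟫_ℂ‖ₑ :=
    ((hv.measurable e).comp measurable_prodMk_left).enorm
  refine (ENNReal.lintegral_mul_le_Lp_mul_Lq μ Real.HolderConjugate.two_two
    m1.aemeasurable m2.aemeasurable).trans ?_
  refine (mul_le_mul' (ENNReal.rpow_le_rpow (hu.bessel τ f) (by positivity))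
    (ENNReal.rpow_le_rpow (hv.bessel τ e) (by positivity))).trans_eq ?_
  rw [← ENNReal.rpow_mul, ← ENNReal.rpow_mul]
  norm_num
  ring

/-- The core estimate. The number `r` allows two uses: `r = 1` for orthonormal families, and `r =
‖f‖ * ‖e‖` for a single pair of arbitrary vectors, which yields boundedness of the form. -/
lemma sum_rpow_le (hu : BesselFamily μ u U) (hv : BesselFamily μ v V) {p : ℝ} (hp : 1 ≤ p)
    {A : X → ℝ≥0∞} (hA : AEMeasurable A μ) {n : ℕ} {e f : Fin n → H} {r : ℝ≥0∞}
    (hnorm : ∀ k, ‖f k‖ₑ * ‖e k‖ₑ ≤ r)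
    (hsum : ∀ x y : H, ∑ k, ‖⟪x, f k⟫_ℂ‖ₑ * ‖⟪y, e k⟫_ℂ‖ₑ ≤ ‖x‖ₑ * ‖y‖ₑ * r) :
    ∑ k, (∫⁻ q, A q.2 * (‖⟪u q.1 q.2, f k⟫_ℂ‖ₑ * ‖⟪v q.1 q.2, e k⟫_ℂ‖ₑ) ∂ν.prod μ) ^ p ≤
      ((∫⁻ τ, U τ * V τ ∂ν) * (∫⁻ w, A w ^ p ∂μ) ^ (1 / p) * r) ^ p := by
  set K := ∫⁻ τ, U τ * V τ ∂ν
  have hp0 : 0 < p := by linarith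
  have hA' : AEMeasurable (fun q : Y × X => A q.2) (ν.prod μ) := hA.comp_snd
  have hm := fun k => (hu.measurable_mul hv (f k) (e k))
  calc _ ≤ ∑ k, (∫⁻ q, A q.2 ^ p * (‖⟪u q.1 q.2, f k⟫_ℂ‖ₑ * ‖⟪v q.1 q.2, e k⟫_ℂ‖ₑ) ∂ν.prod μ) *
        (K * r) ^ (p - 1) := by
        gcongr with k
        -- Hölder with the weight `c_k = |⟪u, f k⟫| |⟪v, e k⟫|`, whose total mass is at most `K * r`
        -- by the Bessel property in `w`.
        refine (lintegral_mul_rpow_le _ hp hA' (hm k).aemeasurable).trans ?_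
        refine mul_le_mul_right (ENNReal.rpow_le_rpow ?_ (by linarith)) _
        exact (hu.lintegral_mul_le hv _ _).trans (mul_le_mul_right (hnorm k) _)
    _ = (∫⁻ q, A q.2 ^ p * ∑ k, (‖⟪u q.1 q.2, f k⟫_ℂ‖ₑ * ‖⟪v q.1 q.2, e k⟫_ℂ‖ₑ) ∂ν.prod μ) *
        (K * r) ^ (p - 1) := by
        rw [← Finset.sum_mul, ← lintegral_finsetSum']
        · simp only [Finset.mul_sum]
        · exact fun k _ => (hA'.pow_const _).mul (hm k).aemeasurable
    -- The other Bessel inequality enters here: at each point the weights sum over `k` to at most `U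
    -- * V * r`, which does not depend on `w`, so the integral factors.
    _ ≤ (∫⁻ q, (U q.1 * V q.1 * r) * A q.2 ^ p ∂ν.prod μ) * (K * r) ^ (p - 1) := by
        refine mul_le_mul_left (lintegral_mono fun q => ?_) _
        rw [mul_comm]
        refine mul_le_mul_left ((hsum _ _).trans (mul_le_mul_left ?_ _)) _
        exact mul_le_mul' (hu.norm_le _ _) (hv.norm_le _ _)
    _ = (K * r) * (∫⁻ w, A w ^ p ∂μ) * (K * r) ^ (p - 1) := by
        rw [lintegral_prod_mul (f := fun τ => U τ * V τ * r) (g := fun w => A w ^ p)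
          ((hu.measurable_mul_bound hv).mul_const r).aemeasurable
          (hA.pow_const _), lintegral_mul_const _ (hu.measurable_mul_bound hv)]
    _ = _ := by
        rw [mul_right_comm _ _ r, ENNReal.mul_rpow_of_nonneg _ _ hp0.le, ← ENNReal.rpow_mul,
          one_div_mul_cancel hp0.ne', ENNReal.rpow_one]
        have : (K * r) ^ p = (K * r) * (K * r) ^ (p - 1) := by
          conv_lhs => rw [show p = 1 + (p - 1) by ring]
          rw [ENNReal.rpow_add_of_nonneg _ _ zero_le_one (by linarith), ENNReal.rpow_one]
        rw [this]; ring

variable {p : ℝ≥0∞} [hp : Fact (1 ≤ p)]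

/-- For `p = ∞` the essential supremum of `a` is pulled out; for finite `p` this is the one-term
case of `sum_rpow_le`, with the `p`-th power removed. -/
lemma lintegral_Lp_le (hu : BesselFamily μ u U) (hv : BesselFamily μ v V) (a : Lp ℂ p μ)
    (f e : H) :
    ∫⁻ q, ‖a q.2‖ₑ * (‖⟪u q.1 q.2, f⟫_ℂ‖ₑ * ‖⟪v q.1 q.2, e⟫_ℂ‖ₑ) ∂ν.prod μ ≤
      (∫⁻ τ, U τ * V τ ∂ν) * ‖a‖ₑ * (‖f‖ₑ * ‖e‖ₑ) := by
  rcases eq_or_ne p ⊤ with rfl | hpt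
  · have hae : ∀ᵐ q ∂ν.prod μ, ‖a q.2‖ₑ ≤ ‖a‖ₑ := by
      have : ∀ᵐ w ∂μ, ‖a w‖ₑ ≤ ‖a‖ₑ := by
        rw [Lp.enorm_def, eLpNorm_exponent_top]
        exact ae_le_eLpNormEssSup
      exact Measure.quasiMeasurePreserving_snd.ae this
    calc _ ≤ ∫⁻ q, ‖a‖ₑ * (‖⟪u q.1 q.2, f⟫_ℂ‖ₑ * ‖⟪v q.1 q.2, e⟫_ℂ‖ₑ) ∂ν.prod μ := by
          refine lintegral_mono_ae ?_
          filter_upwards [hae] with q hq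
          gcongr
      _ = ‖a‖ₑ * ∫⁻ q, ‖⟪u q.1 q.2, f⟫_ℂ‖ₑ * ‖⟪v q.1 q.2, e⟫_ℂ‖ₑ ∂ν.prod μ :=
          lintegral_const_mul _ (hu.measurable_mul hv f e)
      _ ≤ ‖a‖ₑ * ((∫⁻ τ, U τ * V τ ∂ν) * (‖f‖ₑ * ‖e‖ₑ)) := by
          gcongr
          exact hu.lintegral_mul_le hv f e
      _ = _ := by ring
  · have hp1 : 1 ≤ p.toReal := by
      simpa using ENNReal.toReal_mono hpt hp.out
    have hp0 : 0 < p.toReal := by linarith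
    have h := hu.sum_rpow_le hv (ν := ν) hp1 (Lp.aestronglyMeasurable a).enorm (n := 1)
      (e := fun _ => e) (f := fun _ => f) (r := ‖f‖ₑ * ‖e‖ₑ) (fun _ => le_rfl) fun x y => by
        simp only [Finset.univ_unique, Finset.sum_const, Finset.card_singleton, one_smul]
        calc _ ≤ (‖x‖ₑ * ‖f‖ₑ) * (‖y‖ₑ * ‖e‖ₑ) := by
              gcongr <;> exact enorm_inner_le _ _
          _ = _ := by ring
    simp only [Finset.univ_unique, Finset.sum_const, Finset.card_singleton, one_smul] at h
    rw [ENNReal.rpow_le_rpow_iff hp0] at h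
    rwa [Lp.enorm_def, eLpNorm_eq_lintegral_rpow_enorm_toReal (by
      rintro rfl; simp at hp0) hpt]

lemma integrable_mul (hu : BesselFamily μ u U) (hv : BesselFamily μ v V)
    (hK : ∫⁻ τ, U τ * V τ ∂ν ≠ ⊤) (a : Lp ℂ p μ) (f e : H) :
    Integrable (fun q : Y × X => a q.2 * (⟪f, u q.1 q.2⟫_ℂ * ⟪v q.1 q.2, e⟫_ℂ)) (ν.prod μ) := by
  have hm : Measurable fun q : Y × X => ⟪f, u q.1 q.2⟫_ℂ := by
    simp only [← inner_conj_symm f]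
    exact Complex.continuous_conj.measurable.comp (hu.measurable f)
  refine ⟨(Lp.aestronglyMeasurable a).comp_snd.mul
    (hm.mul (hv.measurable e)).aestronglyMeasurable, ?_⟩
  rw [HasFiniteIntegral]
  have : ∀ q : Y × X, ‖a q.2 * (⟪f, u q.1 q.2⟫_ℂ * ⟪v q.1 q.2, e⟫_ℂ)‖ₑ =
      ‖a q.2‖ₑ * (‖⟪u q.1 q.2, f⟫_ℂ‖ₑ * ‖⟪v q.1 q.2, e⟫_ℂ‖ₑ) := fun q => by
    rw [enorm_mul, enorm_mul, enorm_inner_symm f]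
  simp only [this]
  refine (hu.lintegral_Lp_le hv a f e).trans_lt ?_
  finiteness

/-- The right-hand side is a sesquilinear form, bounded by `lintegral_Lp_le`, so the Riesz
representation theorem supplies the operator. -/
lemma exists_operator (hu : BesselFamily μ u U) (hv : BesselFamily μ v V)
    (hK : ∫⁻ τ, U τ * V τ ∂ν ≠ ⊤) (a : Lp ℂ p μ) :
    ∃ T : H →L[ℂ] H, ∀ f e,
      ⟪f, T e⟫_ℂ = ∫ q, a q.2 * (⟪f, u q.1 q.2⟫_ℂ * ⟪v q.1 q.2, e⟫_ℂ) ∂ν.prod μ := by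
  have hi := hu.integrable_mul hv hK a
  let B : H →ₗ⋆[ℂ] H →ₗ[ℂ] ℂ := LinearMap.mk₂'ₛₗ (starRingEnd ℂ) (RingHom.id ℂ)
    (fun f e => ∫ q, a q.2 * (⟪f, u q.1 q.2⟫_ℂ * ⟪v q.1 q.2, e⟫_ℂ) ∂ν.prod μ)
    (fun f f' e => by
      rw [← integral_add (hi f e) (hi f' e)]
      congr 1; funext q; rw [inner_add_left]; ring)
    (fun c f e => by
      rw [smul_eq_mul, ← integral_const_mul]
      congr 1; funext q; rw [inner_smul_left]; ring)
    (fun f e e' => by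
      rw [← integral_add (hi f e) (hi f e')]
      congr 1; funext q; rw [inner_add_right]; ring)
    (fun c f e => by
      rw [smul_eq_mul, ← integral_const_mul]
      congr 1; funext q; rw [inner_smul_right, RingHom.id_apply]; ring)
  let B' : H →L⋆[ℂ] H →L[ℂ] ℂ := B.mkContinuous₂
    ((∫⁻ τ, U τ * V τ ∂ν).toReal * ‖a‖) fun f e => by
      have h1 : ‖B f e‖ₑ ≤ (∫⁻ τ, U τ * V τ ∂ν) * ‖a‖ₑ * (‖f‖ₑ * ‖e‖ₑ) := by
        refine (enorm_integral_le_lintegral_enorm _).trans (le_trans (le_of_eq ?_)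
          (hu.lintegral_Lp_le hv a f e))
        refine lintegral_congr fun q => ?_
        rw [enorm_mul, enorm_mul, enorm_inner_symm f]
      have h2 := ENNReal.toReal_mono (by finiteness) h1
      simpa [ENNReal.toReal_mul, mul_assoc] using h2
  -- The operator `A` attached to the form satisfies `⟪A f, e⟫ = B f e`, with `A` in the first slot;
  -- its adjoint sits in the second.
  refine ⟨ContinuousLinearMap.adjoint (InnerProductSpace.continuousLinearMapOfBilin B'),
    fun f e => ?_⟩
  rw [ContinuousLinearMap.adjoint_inner_right,
    InnerProductSpace.continuousLinearMapOfBilin_apply]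
  rfl

/-- A superposition `∫∫ a w |u τ w⟩⟨v τ w|` with `a ∈ L^p` of rank-one operators from Bessel families
lies in the Schatten class `S^p`. -/
theorem exists_memSchatten (hu : BesselFamily μ u U) (hv : BesselFamily μ v V)
    (hK : ∫⁻ τ, U τ * V τ ∂ν ≠ ⊤) (a : Lp ℂ p μ) :
    ∃ T : H →L[ℂ] H, (∀ f e,
      ⟪f, T e⟫_ℂ = ∫ q, a q.2 * (⟪f, u q.1 q.2⟫_ℂ * ⟪v q.1 q.2, e⟫_ℂ) ∂ν.prod μ) ∧
      MemSchatten p T ∧ schattenNorm p T ≤ (∫⁻ τ, U τ * V τ ∂ν) * ‖a‖ₑ := by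
  obtain ⟨T, hT⟩ := hu.exists_operator hv hK a
  have hfin : (∫⁻ τ, U τ * V τ ∂ν) * ‖a‖ₑ < ⊤ := by finiteness
  have hinner : ∀ f e, ‖⟪f, T e⟫_ℂ‖ₑ ≤
      ∫⁻ q, ‖a q.2‖ₑ * (‖⟪u q.1 q.2, f⟫_ℂ‖ₑ * ‖⟪v q.1 q.2, e⟫_ℂ‖ₑ) ∂ν.prod μ := fun f e => by
    rw [hT]
    refine (enorm_integral_le_lintegral_enorm _).trans_eq (lintegral_congr fun q => ?_)
    rw [enorm_mul, enorm_mul, enorm_inner_symm f]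
  suffices h : (p ≠ ⊤ → IsCompactOperator T) ∧
      schattenNorm p T ≤ (∫⁻ τ, U τ * V τ ∂ν) * ‖a‖ₑ from
    ⟨T, hT, ⟨h.1, h.2.trans_lt hfin⟩, h.2⟩
  rcases eq_or_ne p ⊤ with rfl | hpt
  · refine ⟨fun h => absurd rfl h, ?_⟩
    rw [schattenNorm, if_pos rfl]
    refine enorm_le_of_inner_le fun x y => ?_
    rw [mul_comm ‖x‖ₑ]
    exact (hinner y x).trans (hu.lintegral_Lp_le hv a y x)
  · have hp1 : 1 ≤ p.toReal := by
      simpa using ENNReal.toReal_mono hpt hp.out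
    have hp0 : 0 < p.toReal := by linarith
    -- For finite `p` everything follows from the criterion on orthonormal families, which is the
    -- core estimate with `r = 1`.
    have hO : OrthoSumLE T p.toReal (((∫⁻ τ, U τ * V τ ∂ν) * ‖a‖ₑ) ^ p.toReal) := by
      intro n e f he hf
      have h := hu.sum_rpow_le hv (ν := ν) hp1 (Lp.aestronglyMeasurable a).enorm (e := e) (f := f)
        (r := 1) (fun k => by
          rw [← ofReal_norm, ← ofReal_norm, he.1 k, hf.1 k]; simp) fun x y => by
        rw [mul_one]; exact sum_enorm_inner_mul_le he hf x y
      rw [mul_one] at h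
      refine (Finset.sum_le_sum fun k _ => ENNReal.rpow_le_rpow (hinner (f k) (e k)) hp0.le).trans
        (h.trans_eq ?_)
      rw [Lp.enorm_def, eLpNorm_eq_lintegral_rpow_enorm_toReal (by
        rintro rfl; simp at hp0) hpt]
    have hcomp := hO.isCompactOperator hp0 (by finiteness)
    refine ⟨fun _ => hcomp, ?_⟩
    rw [schattenNorm, if_neg hpt]
    refine (ENNReal.rpow_le_rpow (hO.posTrace_le hp0 hcomp) (by positivity)).trans_eq ?_
    rw [← ENNReal.rpow_mul, mul_one_div_cancel hp0.ne', ENNReal.rpow_one]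

end BesselFamily

end Superposition

end WeylCalc
end
noncomputable section
namespace WeylCalc

/-! ### Plancherel's inequality and time-frequency shifts -/

section Plancherel

variable {V : Type} [NormedAddCommGroup V] [InnerProductSpace ℝ V] [FiniteDimensional ℝ V]
  [MeasurableSpace V] [BorelSpace V]

/-- The integral and the `L²` extension define the same distribution: tested against smooth
compactly supported functions, both reduce to the multiplication formula `∫ ŝ f = ∫ s f̂`. -/
lemma fourier_ae_eq_toLp {f : V → ℂ} (hf : Integrable f) (hf2 : MemLp f 2) :
    𝓕 f =ᵐ[volume] (𝓕 (hf2.toLp f) : Lp ℂ 2 (volume : Measure V)) := by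
  have hcont : Continuous (𝓕 f) :=
    VectorFourier.fourierIntegral_continuous Real.continuous_fourierChar
      (innerSL ℝ (E := V)).continuous₂ hf
  refine ae_eq_of_integral_contDiff_smul_eq hcont.locallyIntegrable
    ((Lp.memLp _).locallyIntegrable (by norm_num)) fun g hg hgc => ?_
  have hg₁ : HasCompactSupport (Complex.ofRealCLM ∘ g) := hgc.comp_left rfl
  have hg₂ : ContDiff ℝ ∞ (Complex.ofRealCLM ∘ g) := by fun_prop
  let s : 𝓢(V, ℂ) := hg₁.toSchwartzMap hg₂
  have hs : ∀ x, s x = (g x : ℂ) := fun x => rfl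
  have h1 := congrArg (fun u : 𝓢'(V, ℂ) => u s)
    (Lp.fourier_toTemperedDistribution_eq (hf2.toLp f))
  simp only [TemperedDistribution.fourier_apply, Lp.toTemperedDistribution_apply] at h1
  have h2 : ∫ x, (𝓕 s) x • (hf2.toLp f) x = ∫ x, (𝓕 s) x • f x := by
    refine integral_congr_ae ?_
    filter_upwards [hf2.coeFn_toLp] with x hx
    rw [hx]
  have h3 : ∫ x, (𝓕 s) x • f x = ∫ x, s x • 𝓕 f x := by
    have := VectorFourier.integral_fourierIntegral_smul_eq_flip (L := innerₗ V)
      (μ := volume) (ν := volume) (f := s) (g := f)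
      Real.continuous_fourierChar (innerSL ℝ (E := V)).continuous₂ s.integrable hf
    rw [flip_innerₗ] at this
    exact this
  calc ∫ x, g x • 𝓕 f x = ∫ x, s x • 𝓕 f x := by simp [hs]
    _ = ∫ x, s x • (𝓕 (hf2.toLp f) : Lp ℂ 2 (volume : Measure V)) x := by rw [← h3, ← h2, h1]
    _ = _ := by simp [hs]

/-- Stated as an inequality so that no square integrability is needed: when the right-hand side is
infinite there is nothing to prove, and otherwise Plancherel applies. -/
lemma lintegral_fourier_sq_le {f : V → ℂ} (hf : Integrable f) :
    ∫⁻ ξ, ‖𝓕 f ξ‖ₑ ^ (2 : ℝ) ≤ ∫⁻ x, ‖f x‖ₑ ^ (2 : ℝ) := by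
  rcases eq_or_ne (∫⁻ x, ‖f x‖ₑ ^ (2 : ℝ)) ⊤ with h | h
  · rw [h]; exact le_top
  have hf2 : MemLp f 2 := by
    refine ⟨hf.1, ?_⟩
    rw [eLpNorm_lt_top_iff_lintegral_rpow_enorm_lt_top (by norm_num) (by norm_num)]
    simpa using h.lt_top
  have e : eLpNorm (𝓕 f) 2 volume = eLpNorm f 2 volume := by
    rw [eLpNorm_congr_ae (fourier_ae_eq_toLp hf hf2), ← Lp.enorm_def, ← ofReal_norm,
      Lp.norm_fourier_eq, ofReal_norm, Lp.enorm_def, eLpNorm_congr_ae hf2.coeFn_toLp]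
  rw [eLpNorm_eq_lintegral_rpow_enorm_toReal (by norm_num) (by norm_num),
    eLpNorm_eq_lintegral_rpow_enorm_toReal (by norm_num) (by norm_num)] at e
  simp only [ENNReal.toReal_ofNat] at e
  exact ((ENNReal.rpow_left_injective (by norm_num : (1 / 2 : ℝ) ≠ 0)) e).le

end Plancherel

section TimeFrequency

variable {d : ℕ}

/-- The time-frequency shift `t ↦ exp (2 π i t · ω) b (t - y)` by `w = (y, ω)`. -/
def tfShift (w : Phase d) (b : Rn d → ℂ) (t : Rn d) : ℂ := 𝐞 ⟪t, w.2⟫_ℝ • b (t - w.1)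

lemma enorm_tfShift (w : Phase d) (b : Rn d → ℂ) (t : Rn d) :
    ‖tfShift w b t‖ₑ = ‖b (t - w.1)‖ₑ := by
  rw [tfShift, ← ofReal_norm, ← ofReal_norm, Circle.norm_smul]

lemma memLp_tfShift {b : Rn d → ℂ} (hb : MemLp b 2) (w : Phase d) : MemLp (tfShift w b) 2 := by
  have h := hb.comp_measurePreserving (measurePreserving_sub_right volume w.1)
  have hc : Continuous fun t : Rn d => 𝐞 ⟪t, w.2⟫_ℝ := by fun_prop
  exact MemLp.of_le h (hc.aestronglyMeasurable.smul h.1)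
    (Filter.Eventually.of_forall fun t => (Circle.norm_smul _ _).le)

lemma eLpNorm_tfShift {b : Rn d → ℂ} (hb : MemLp b 2) (w : Phase d) :
    eLpNorm (tfShift w b) 2 volume = eLpNorm b 2 volume := by
  rw [← eLpNorm_comp_measurePreserving hb.1 (measurePreserving_sub_right volume w.1)]
  exact eLpNorm_congr_enorm_ae (Filter.Eventually.of_forall fun t => enorm_tfShift w b t)

/-- The time-frequency shift of a square integrable function as an element of `L²`. -/
def tfShiftLp {b : Rn d → ℂ} (hb : MemLp b 2) (w : Phase d) : L2 d :=
  (memLp_tfShift hb w).toLp _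

lemma inner_tfShiftLp {b : Rn d → ℂ} (hb : MemLp b 2) (w : Phase d) (f : L2 d) :
    ⟪tfShiftLp hb w, f⟫_ℂ = ∫ t, starRingEnd ℂ (tfShift w b t) * f t := by
  rw [L2.inner_def]
  refine integral_congr_ae ?_
  filter_upwards [(memLp_tfShift hb w).coeFn_toLp] with t ht
  rw [tfShiftLp, ht, RCLike.inner_apply, mul_comm]

lemma conj_tfShift_mul (w : Phase d) (b : Rn d → ℂ) (t : Rn d) (z : ℂ) :
    starRingEnd ℂ (tfShift w b t) * z =
      𝐞 (-⟪t, w.2⟫_ℝ) • (starRingEnd ℂ (b (t - w.1)) * z) := by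
  rw [tfShift, Circle.smul_def, Circle.smul_def, smul_eq_mul, smul_eq_mul, map_mul,
    AddChar.map_neg_eq_inv, Circle.coe_inv_eq_conj, mul_assoc]

/-- As a function of the frequency shift, the coefficient is a Fourier transform (the short-time
Fourier transform of `f` with window `b`). This makes Plancherel in the frequency variable
available. -/
lemma inner_tfShiftLp_eq_fourier {b : Rn d → ℂ} (hb : MemLp b 2) (w : Phase d) (f : L2 d) :
    ⟪tfShiftLp hb w, f⟫_ℂ = 𝓕 (fun t => starRingEnd ℂ (b (t - w.1)) * f t) w.2 := by
  rw [inner_tfShiftLp, Real.fourier_eq]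
  exact integral_congr_ae (Filter.Eventually.of_forall fun t => conj_tfShift_mul w b t _)

lemma lintegral_enorm_sq_eq {α : Type} [MeasurableSpace α] {μ : Measure α} (f : α → ℂ) :
    ∫⁻ x, ‖f x‖ₑ ^ (2 : ℝ) ∂μ = (eLpNorm f 2 μ) ^ (2 : ℝ) := by
  rw [eLpNorm_eq_lintegral_rpow_enorm_toReal (by norm_num) (by norm_num), ← ENNReal.rpow_mul]
  norm_num

lemma measurable_tfShift {Y : Type} [MeasurableSpace Y] {b : Y → Rn d → ℂ}
    (hm : Measurable (Function.uncurry b)) :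
    Measurable fun r : (Y × Phase d) × Rn d => tfShift r.1.2 (b r.1.1) r.2 := by
  have g1 : Measurable fun r : (Y × Phase d) × Rn d => (r.1.1, r.2 - r.1.2.1) := by fun_prop
  have h1 := hm.comp g1
  have h2 : Measurable fun r : (Y × Phase d) × Rn d => ((𝐞 ⟪r.2, r.1.2.2⟫_ℝ : Circle) : ℂ) := by
    fun_prop
  have h3 : (fun r : (Y × Phase d) × Rn d => tfShift r.1.2 (b r.1.1) r.2) =
      fun r => ((𝐞 ⟪r.2, r.1.2.2⟫_ℝ : Circle) : ℂ) * b r.1.1 (r.2 - r.1.2.1) := by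
    funext r; rw [tfShift, Circle.smul_def, smul_eq_mul]
  rw [h3]
  exact Measurable.mul h2 h1

lemma measurable_inner_tfShiftLp {Y : Type} [MeasurableSpace Y] {b : Y → Rn d → ℂ}
    (hb : ∀ τ, MemLp (b τ) 2) (hm : Measurable (Function.uncurry b)) (f : L2 d) :
    Measurable fun q : Y × Phase d => ⟪tfShiftLp (hb q.1) q.2, f⟫_ℂ := by
  simp only [inner_tfShiftLp]
  have hf : Measurable fun r : (Y × Phase d) × Rn d => f r.2 :=
    (Lp.stronglyMeasurable f).measurable.comp measurable_snd
  have h := (Complex.continuous_conj.measurable.comp (measurable_tfShift hm)).mul hf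
  exact (h.stronglyMeasurable.integral_prod_right' (ν := volume)).measurable

lemma measurable_eLpNorm {Y : Type} [MeasurableSpace Y] {b : Y → Rn d → ℂ}
    (hm : Measurable (Function.uncurry b)) : Measurable fun τ => eLpNorm (b τ) 2 volume := by
  have h : Measurable fun r : Y × Rn d => ‖Function.uncurry b r‖ₑ ^ (2 : ℝ) :=
    hm.enorm.pow_const _
  have h' := (h.lintegral_prod_right' (ν := (volume : Measure (Rn d)))).pow_const (1 / 2 : ℝ)
  convert h' using 2 with τ
  rw [eLpNorm_eq_lintegral_rpow_enorm_toReal (two_ne_zero) (ENNReal.ofNat_ne_top)]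
  simp

/-- Time-frequency shifts of square integrable functions form a Bessel family. -/
theorem besselFamily_tfShiftLp {Y : Type} [MeasurableSpace Y] {b : Y → Rn d → ℂ}
    (hb : ∀ τ, MemLp (b τ) 2) (hm : Measurable (Function.uncurry b)) :
    BesselFamily (volume : Measure (Phase d)) (fun τ w => tfShiftLp (hb τ) w)
      (fun τ => eLpNorm (b τ) 2 volume) where
  norm_le τ w := by
    rw [tfShiftLp, Lp.enorm_toLp, eLpNorm_tfShift (hb τ)]
  measurable f := measurable_inner_tfShiftLp hb hm f
  measurable_bound := measurable_eLpNorm hm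
  bessel τ f := by
    have hmeas : Measurable fun w : Phase d => ⟪tfShiftLp (hb τ) w, f⟫_ℂ := by
      have h0 : Measurable fun w : Phase d => (τ, w) := measurable_prodMk_left
      have h1 := (measurable_inner_tfShiftLp hb hm f).comp h0
      simpa only [Function.comp_def] using h1
    have hmb : Measurable (b τ) := by
      have h0 : Measurable fun t : Rn d => (τ, t) := measurable_prodMk_left
      have := hm.comp h0
      exact this
    have hmf : Measurable f := (Lp.stronglyMeasurable f).measurable
    rw [Measure.volume_eq_prod, lintegral_prod _ (hmeas.enorm.pow_const _).aemeasurable]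
    have hint : ∀ y, Integrable fun t => starRingEnd ℂ (b τ (t - y)) * f t := fun y => by
      have h := (hb τ).comp_measurePreserving (measurePreserving_sub_right volume y)
      exact MemLp.integrable_mul h.star (Lp.memLp f)
    -- Plancherel in the frequency shift for each fixed `y`; then Tonelli and translation invariance
    -- in `y` separate the norms of `b τ` and `f`.
    calc _ ≤ ∫⁻ y : Rn d, ∫⁻ t, ‖b τ (t - y)‖ₑ ^ (2 : ℝ) * ‖f t‖ₑ ^ (2 : ℝ) := by
          refine lintegral_mono fun y => ?_
          simp only [inner_tfShiftLp_eq_fourier]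
          refine (lintegral_fourier_sq_le (hint y)).trans_eq (lintegral_congr fun t => ?_)
          rw [enorm_mul, ENNReal.mul_rpow_of_nonneg _ _ (by norm_num), ← ofReal_norm,
            RCLike.norm_conj, ofReal_norm]
      _ = ∫⁻ t, ∫⁻ y : Rn d, ‖b τ (t - y)‖ₑ ^ (2 : ℝ) * ‖f t‖ₑ ^ (2 : ℝ) := by
          refine lintegral_lintegral_swap (Measurable.aemeasurable ?_)
          exact ((hmb.comp (measurable_snd.sub measurable_fst)).enorm.pow_const _).mul
            ((hmf.comp measurable_snd).enorm.pow_const _)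
      _ = ∫⁻ t, (∫⁻ y, ‖b τ y‖ₑ ^ (2 : ℝ)) * ‖f t‖ₑ ^ (2 : ℝ) := by
          refine lintegral_congr fun t => ?_
          have h0 : Measurable fun y : Rn d => t - y := measurable_const.sub measurable_id
          have h1 : Measurable fun y : Rn d => ‖b τ (t - y)‖ₑ ^ (2 : ℝ) :=
            (hmb.comp h0).enorm.pow_const _
          rw [lintegral_mul_const _ h1]
          rw [lintegral_sub_left_eq_self (μ := volume) (fun y => ‖b τ y‖ₑ ^ (2 : ℝ)) t]
      _ = _ := by
          rw [lintegral_const_mul _ (hmf.enorm.pow_const _), lintegral_enorm_sq_eq,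
            lintegral_enorm_sq_eq, ← Lp.enorm_def,
            ENNReal.mul_rpow_of_nonneg _ _ (by norm_num)]

end TimeFrequency

end WeylCalc
end
noncomputable section
namespace WeylCalc

/-! ### Differential operators with polynomial coefficients -/

section WeylAlgebra

open LineDeriv

variable {d : ℕ}

/-- The algebra of linear operators on Schwartz functions on phase space. -/
abbrev SchwartzEnd (d : ℕ) : Type := Module.End ℂ 𝓢(Phase d, ℂ)

/-- The coordinate functional `z ↦ z_i`. -/
def coordCLM (d : ℕ) : Fin d ⊕ Fin d → (Phase d →L[ℝ] ℝ)
  | Sum.inl j => (EuclideanSpace.proj j).comp (ContinuousLinearMap.fst ℝ (Rn d) (Rn d))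
  | Sum.inr j => (EuclideanSpace.proj j).comp (ContinuousLinearMap.snd ℝ (Rn d) (Rn d))

lemma coordCLM_apply (i : Fin d ⊕ Fin d) (z : Phase d) : coordCLM d i z = phaseCoord z i := by
  cases i <;> rfl

lemma coordCLM_phaseBasis (i j : Fin d ⊕ Fin d) :
    coordCLM d i (phaseBasis d j) = if i = j then 1 else 0 := by
  rcases i with i | i <;> rcases j with j | j <;>
    simp [coordCLM_apply, phaseCoord, phaseBasis, eq_comm]

/-- Partial differentiation. -/
def derivOp (i : Fin d ⊕ Fin d) : SchwartzEnd d :=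
  (lineDerivOpCLM ℂ 𝓢(Phase d, ℂ) (phaseBasis d i)).toLinearMap

lemma coord_temperate (i : Fin d ⊕ Fin d) :
    Function.HasTemperateGrowth fun z : Phase d => (coordCLM d i z : ℂ) := by
  exact (Complex.ofRealCLM.comp (coordCLM d i)).hasTemperateGrowth

/-- Multiplication by a coordinate. -/
def coordOp (i : Fin d ⊕ Fin d) : SchwartzEnd d :=
  (smulLeftCLM ℂ fun z : Phase d => (coordCLM d i z : ℂ)).toLinearMap

lemma derivOp_apply (i : Fin d ⊕ Fin d) (F : 𝓢(Phase d, ℂ)) (z : Phase d) :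
    derivOp i F z = fderiv ℝ F z (phaseBasis d i) := rfl

lemma coordOp_apply (i : Fin d ⊕ Fin d) (F : 𝓢(Phase d, ℂ)) (z : Phase d) :
    coordOp i F z = phaseCoord z i * F z := by
  rw [← coordCLM_apply]
  exact smulLeftCLM_apply_apply (coord_temperate i) F z

lemma derivOp_comm (i j : Fin d ⊕ Fin d) : Commute (derivOp i) (derivOp j) := by
  ext F z
  change fderiv ℝ (derivOp j F) z (phaseBasis d i) = fderiv ℝ (derivOp i F) z (phaseBasis d j)
  have h : ∀ k, (derivOp k F : Phase d → ℂ) = fun z => fderiv ℝ F z (phaseBasis d k) :=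
    fun k => rfl
  have hd : DifferentiableAt ℝ (fderiv ℝ F) z :=
    ((F.smooth 2).fderiv_right (m := 1) (by norm_num)).differentiable (by norm_num) z
  rw [h, h, fderiv_clm_apply hd (differentiableAt_const _),
    fderiv_clm_apply hd (differentiableAt_const _)]
  simp only [fderiv_fun_const, Pi.zero_apply, ContinuousLinearMap.comp_zero, zero_add,
    ContinuousLinearMap.flip_apply]
  exact ((F.smooth 2).contDiffAt.isSymmSndFDerivAt (by simp)).eq _ _

lemma coordOp_comm (i j : Fin d ⊕ Fin d) : Commute (coordOp i) (coordOp j) := by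
  ext F z
  change coordOp i (coordOp j F) z = coordOp j (coordOp i F) z
  simp only [coordOp_apply]
  ring

/-- The canonical commutation relation, which is the product rule. It is the only relation used to
bring words into normal order. -/
lemma coordOp_mul_derivOp (i j : Fin d ⊕ Fin d) :
    coordOp j * derivOp i = derivOp i * coordOp j -
      (if j = i then (1 : ℂ) else 0) • (1 : SchwartzEnd d) := by
  ext F z
  change coordOp j (derivOp i F) z = derivOp i (coordOp j F) z - (if j = i then (1 : ℂ) else 0) * F z
  rw [coordOp_apply, derivOp_apply, derivOp_apply]
  have h : (coordOp j F : Phase d → ℂ) = fun z => (coordCLM d j z : ℂ) * F z := by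
    funext z; rw [coordOp_apply, coordCLM_apply]
  have h1 : HasFDerivAt (fun z => (coordCLM d j z : ℂ))
      (Complex.ofRealCLM.comp (coordCLM d j)) z :=
    (Complex.ofRealCLM.comp (coordCLM d j)).hasFDerivAt
  rw [h, (h1.fun_mul (F.hasFDerivAt z)).fderiv]
  have h2 := coordCLM_phaseBasis (d := d) j i
  simp only [add_apply, smul_apply, ContinuousLinearMap.comp_apply, h2, coordCLM_apply, smul_eq_mul,
    Complex.ofRealCLM_apply]
  split_ifs <;> simp

/-- The span of the products of at most `N` derivations and coordinate multiplications, with the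
derivations on the left. -/
def orderedSpan (d N : ℕ) : Submodule ℂ (SchwartzEnd d) :=
  Submodule.span ℂ {X | ∃ l m : List (Fin d ⊕ Fin d), l.length + m.length ≤ N ∧
    X = (l.map derivOp).prod * (m.map coordOp).prod}

lemma orderedSpan_mono {M N : ℕ} (h : M ≤ N) : orderedSpan d M ≤ orderedSpan d N := by
  refine Submodule.span_mono ?_
  rintro X ⟨l, m, hlm, rfl⟩
  exact ⟨l, m, hlm.trans h, rfl⟩

/-- `X` raises the order of normally ordered differential operators by at most `k`. -/
def HasOrder (k : ℕ) (X : SchwartzEnd d) : Prop :=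
  ∀ N, ∀ Y ∈ orderedSpan d N, X * Y ∈ orderedSpan d (N + k)

lemma hasOrder_of_generators {k : ℕ} {X : SchwartzEnd d}
    (h : ∀ l m : List (Fin d ⊕ Fin d), X * ((l.map derivOp).prod * (m.map coordOp).prod) ∈
      orderedSpan d (l.length + m.length + k)) : HasOrder k X := by
  intro N Y hY
  induction hY using Submodule.span_induction with
  | mem Y hY =>
    obtain ⟨l, m, hlm, rfl⟩ := hY
    exact orderedSpan_mono (by omega) (h l m)
  | zero => simp
  | add Y Y' _ _ h h' => rw [mul_add]; exact add_mem h h'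
  | smul c Y _ h => rw [mul_smul_comm]; exact Submodule.smul_mem _ _ h

lemma hasOrder_derivOp (i : Fin d ⊕ Fin d) : HasOrder 1 (derivOp i) := by
  refine hasOrder_of_generators fun l m => Submodule.subset_span ⟨i :: l, m, ?_, ?_⟩
  · simp only [List.length_cons]; omega
  · simp [mul_assoc]

/-- The coordinate is moved to the right past one derivation at a time. Each commutator deletes that
derivation, giving a shorter word. -/
lemma hasOrder_coordOp (j : Fin d ⊕ Fin d) : HasOrder 1 (coordOp j) := by
  refine hasOrder_of_generators fun l m => ?_
  induction l with
  | nil => exact Submodule.subset_span ⟨[], j :: m, by simp, by simp⟩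
  | cons i l ih =>
    have h : coordOp j * (((i :: l).map derivOp).prod * (m.map coordOp).prod) =
        derivOp i * (coordOp j * ((l.map derivOp).prod * (m.map coordOp).prod)) -
        (if j = i then (1 : ℂ) else 0) • ((l.map derivOp).prod * (m.map coordOp).prod) := by
      rw [List.map_cons, List.prod_cons, mul_assoc, ← mul_assoc (coordOp j), coordOp_mul_derivOp,
        sub_mul, smul_mul_assoc, one_mul, mul_assoc]
    rw [h]
    refine sub_mem ?_ (Submodule.smul_mem _ _ ?_)
    · have := hasOrder_derivOp i _ _ ih
      refine orderedSpan_mono ?_ this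
      simp only [List.length_cons]; omega
    · exact Submodule.subset_span ⟨l, m, by simp only [List.length_cons]; omega, rfl⟩

namespace HasOrder

variable {k k' : ℕ} {X X' : SchwartzEnd d}

lemma mono (h : HasOrder k X) (hk : k ≤ k') : HasOrder k' X := fun N Y hY =>
  orderedSpan_mono (by omega) (h N Y hY)

lemma one : HasOrder 0 (1 : SchwartzEnd d) := fun N Y hY => by simpa using hY

lemma mul (h : HasOrder k X) (h' : HasOrder k' X') : HasOrder (k + k') (X * X') :=
  fun N Y hY => by
    rw [mul_assoc]
    have := h _ _ (h' N Y hY)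
    rwa [add_assoc, add_comm k'] at this

lemma add (h : HasOrder k X) (h' : HasOrder k X') : HasOrder k (X + X') := fun N Y hY => by
  rw [add_mul]; exact add_mem (h N Y hY) (h' N Y hY)

lemma smul (c : ℂ) (h : HasOrder k X) : HasOrder k (c • X) := fun N Y hY => by
  rw [smul_mul_assoc]; exact Submodule.smul_mem _ _ (h N Y hY)

lemma sum {ι : Type} (s : Finset ι) {X : ι → SchwartzEnd d} (h : ∀ i ∈ s, HasOrder k (X i)) :
    HasOrder k (∑ i ∈ s, X i) := fun N Y hY => by
  rw [Finset.sum_mul]; exact sum_mem fun i hi => h i hi N Y hY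

lemma pow (h : HasOrder k X) (n : ℕ) : HasOrder (n * k) (X ^ n) := by
  induction n with
  | zero => simpa using HasOrder.one
  | succ n ih => rw [pow_succ, add_mul, one_mul]; exact ih.mul h

lemma mem_orderedSpan (h : HasOrder k X) : X ∈ orderedSpan d k := by
  have h1 : (1 : SchwartzEnd d) ∈ orderedSpan d 0 :=
    Submodule.subset_span ⟨[], [], by simp, by simp⟩
  simpa using h 0 1 h1

end HasOrder

lemma mul_prod_map_pow {ι M : Type} [DecidableEq ι] [Monoid M] (x : ι → M)
    (hx : ∀ i j, Commute (x i) (x j)) (α : ι → ℕ) (j : ι) :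
    ∀ {L : List ι}, L.Nodup → j ∈ L →
      x j * (L.map fun i => x i ^ α i).prod =
        (L.map fun i => x i ^ (α i + (Pi.single j 1 : ι → ℕ) i)).prod
  | [], _, h => by simp at h
  | i :: L, hL, h => by
    rw [List.nodup_cons] at hL
    rw [List.map_cons, List.prod_cons, List.map_cons, List.prod_cons]
    rcases eq_or_ne i j with rfl | hij
    · rw [← mul_assoc, Pi.single_eq_same, pow_succ']
      congr 2
      refine List.map_congr_left fun k hk => ?_
      have : k ≠ i := fun e => hL.1 (e ▸ hk)
      simp [this]
    · have hj : j ∈ L := by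
        rcases List.mem_cons.1 h with e | e
        · exact absurd e.symm hij
        · exact e
      rw [← mul_assoc, ((hx j i).pow_right _).eq, mul_assoc, mul_prod_map_pow x hx α j hL.2 hj,
        Pi.single_eq_of_ne hij, add_zero]

/-- Commuting letters may be collected by kind. The fixed list `L` prescribes the order in which the
powers appear, so that they match the iterated derivatives and monomials in `weightedNorm`. -/
lemma exists_multiIndex {ι M : Type} [Fintype ι] [DecidableEq ι] [Monoid M] (x : ι → M)
    (hx : ∀ i j, Commute (x i) (x j)) {L : List ι} (hL : L.Nodup) (hmem : ∀ i, i ∈ L)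
    (l : List ι) : ∃ α : ι → ℕ, ∑ i, α i = l.length ∧
      (l.map x).prod = (L.map fun i => x i ^ α i).prod := by
  induction l with
  | nil => exact ⟨0, by simp, by simp⟩
  | cons j l ih =>
    obtain ⟨α, h1, h2⟩ := ih
    refine ⟨α + Pi.single j 1, ?_, ?_⟩
    · simp [Finset.sum_add_distrib, h1]
    · rw [List.map_cons, List.prod_cons, h2, mul_prod_map_pow x hx α j hL (hmem j)]
      rfl

lemma phaseIndices_nodup : (phaseIndices d).Nodup := by
  refine List.Nodup.append ((List.nodup_finRange d).map Sum.inl_injective)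
    ((List.nodup_finRange d).map Sum.inr_injective) ?_
  intro a h1 h2
  simp at h1 h2
  obtain ⟨_, rfl⟩ := h1
  simp at h2

lemma mem_phaseIndices (i : Fin d ⊕ Fin d) : i ∈ phaseIndices d := by
  rcases i with i | i <;> simp [phaseIndices]

lemma derivOp_pow_apply (i : Fin d ⊕ Fin d) (n : ℕ) (F : 𝓢(Phase d, ℂ)) :
    ((derivOp i ^ n) F : Phase d → ℂ) =
      (fun (f : Phase d → ℂ) z => lineDeriv ℝ f z (phaseBasis d i))^[n] F := by
  induction n with
  | zero => rfl
  | succ n ih =>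
    rw [Function.iterate_succ_apply', ← ih, pow_succ']
    funext z
    exact lineDerivOp_apply (phaseBasis d i) ((derivOp i ^ n) F) z

lemma derivOp_prod_apply (α : Fin d ⊕ Fin d → ℕ) (F : 𝓢(Phase d, ℂ)) :
    (((phaseIndices d).map fun i => derivOp i ^ α i).prod F : Phase d → ℂ) =
      multiDeriv α F := by
  unfold multiDeriv
  induction phaseIndices d with
  | nil => rfl
  | cons i L ih =>
    rw [List.map_cons, List.prod_cons, List.foldr_cons, ← ih]
    exact derivOp_pow_apply i (α i) _

lemma coordOp_pow_apply (i : Fin d ⊕ Fin d) (n : ℕ) (F : 𝓢(Phase d, ℂ)) (z : Phase d) :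
    (coordOp i ^ n) F z = (phaseCoord z i : ℂ) ^ n * F z := by
  induction n with
  | zero => simp
  | succ n ih =>
    rw [pow_succ']
    change coordOp i ((coordOp i ^ n) F) z = _
    rw [coordOp_apply, ih]; ring

lemma coordOp_prod_apply (β : Fin d ⊕ Fin d → ℕ) (F : 𝓢(Phase d, ℂ)) (z : Phase d) :
    ((phaseIndices d).map fun i => coordOp i ^ β i).prod F z = (monomialFun β z : ℂ) * F z := by
  have h : ∀ L : List (Fin d ⊕ Fin d), (L.map fun i => coordOp i ^ β i).prod F z =
      (L.map fun i => (phaseCoord z i : ℂ) ^ β i).prod * F z := by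
    intro L
    induction L with
    | nil => simp
    | cons i L ih =>
      rw [List.map_cons, List.prod_cons, List.map_cons, List.prod_cons, mul_assoc, ← ih]
      exact coordOp_pow_apply i (β i) _ z
  have hu : (phaseIndices d).toFinset = Finset.univ :=
    Finset.eq_univ_iff_forall.2 fun i => List.mem_toFinset.2 (mem_phaseIndices i)
  rw [h, monomialFun, Complex.ofReal_prod, ← List.prod_toFinset _ phaseIndices_nodup, hu]
  simp only [Complex.ofReal_pow]

lemma eLpNorm_le_weightedNorm_of_mem {N : ℕ} (γ : (Fin d ⊕ Fin d → ℕ) × (Fin d ⊕ Fin d → ℕ)) (h : γ ∈ multiIndexPairs d N) (F : 𝓢(Phase d, ℂ)) :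
    eLpNorm (multiDeriv γ.1 (fun z => (monomialFun γ.2 z : ℂ) * F z)) 2 volume ≤ weightedNorm N F := by
  unfold weightedNorm
  have := Finset.single_le_sum (f := fun γ : (Fin d ⊕ Fin d → ℕ) × (Fin d ⊕ Fin d → ℕ) =>
    eLpNorm (multiDeriv γ.1 (fun z => (monomialFun γ.2 z : ℂ) * F z)) 2 volume)
    (fun _ _ => zero_le) h
  exact this
lemma derivOp_prod_coordOp_prod_apply (α β : Fin d ⊕ Fin d → ℕ) (F : 𝓢(Phase d, ℂ)) : ((((phaseIndices d).map fun i => derivOp i ^ α i).prod *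
      ((phaseIndices d).map fun i => coordOp i ^ β i).prod : SchwartzEnd d) F : Phase d → ℂ) = multiDeriv α (fun z => (monomialFun β z : ℂ) * F z) := by
  have h1 := derivOp_prod_apply α (((phaseIndices d).map fun i => coordOp i ^ β i).prod F)
  rw [funext (coordOp_prod_apply β F)] at h1
  rw [Module.End.mul_apply, h1]
lemma eLpNorm_multiIndex_le {N : ℕ} (α β : Fin d ⊕ Fin d → ℕ)
    (h : ∑ i, α i + ∑ i, β i ≤ N) (F : 𝓢(Phase d, ℂ)) :
    eLpNorm ((((phaseIndices d).map fun i => derivOp i ^ α i).prod *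
      ((phaseIndices d).map fun i => coordOp i ^ β i).prod : SchwartzEnd d) F) 2 volume ≤
      weightedNorm N F := by
  rw [derivOp_prod_coordOp_prod_apply]
  have hmem : (α, β) ∈ multiIndexPairs d N := (mem_multiIndexPairs (α, β)).2 h
  have := eLpNorm_le_weightedNorm_of_mem _ hmem F
  exact this

lemma eLpNorm_le_weightedNorm {N : ℕ} {X : SchwartzEnd d} (hX : X ∈ orderedSpan d N) :
    ∃ C : NNReal, ∀ F : 𝓢(Phase d, ℂ), eLpNorm (X F) 2 volume ≤ C * weightedNorm N F := by
  induction hX using Submodule.span_induction with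
  | mem Y hY =>
    obtain ⟨l, m, hlm, rfl⟩ := hY
    obtain ⟨α, hα, hα'⟩ := exists_multiIndex derivOp derivOp_comm (phaseIndices_nodup (d := d))
      mem_phaseIndices l
    obtain ⟨β, hβ, hβ'⟩ := exists_multiIndex coordOp coordOp_comm (phaseIndices_nodup (d := d))
      mem_phaseIndices m
    -- A normally ordered word is exactly one summand of the weighted norm; constants other than `1`
    -- arise only from linear combinations.
    refine ⟨1, fun F => ?_⟩
    rw [hα', hβ', ENNReal.coe_one, one_mul]
    exact eLpNorm_multiIndex_le α β (by rw [hα, hβ]; exact hlm) F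
  | zero => exact ⟨0, fun F => by simp⟩
  | add Y Y' _ _ h h' =>
    obtain ⟨C, hC⟩ := h
    obtain ⟨C', hC'⟩ := h'
    refine ⟨C + C', fun F => ?_⟩
    have h1 : AEStronglyMeasurable (Y F) (volume : Measure (Phase d)) :=
      (Y F).continuous.aestronglyMeasurable
    have h2 : AEStronglyMeasurable (Y' F) (volume : Measure (Phase d)) :=
      (Y' F).continuous.aestronglyMeasurable
    have h3 := (eLpNorm_add_le h1 h2 one_le_two).trans (add_le_add (hC F) (hC' F))
    rw [ENNReal.coe_add, add_mul]
    exact h3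
  | smul c Y _ h =>
    obtain ⟨C, hC⟩ := h
    refine ⟨‖c‖₊ * C, fun F => ?_⟩
    have h1 := eLpNorm_const_smul c (Y F : Phase d → ℂ) 2 (volume : Measure (Phase d))
    have h2 : ‖c‖ₑ * eLpNorm (Y F) 2 volume ≤ ‖c‖ₑ * (C * weightedNorm N F) := by
      gcongr
      exact hC F
    rw [ENNReal.coe_mul, mul_assoc]
    exact h1.le.trans h2

end WeylAlgebra

end WeylCalc
end
noncomputable section
namespace WeylCalc

/-! ### Intertwining relations for the passage from symbols to kernels -/

section Intertwining

open LineDeriv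

variable {d : ℕ}

/-- The partial Fourier transform as an element of the operator algebra. -/
def fourierOp (d : ℕ) : SchwartzEnd d := (partialFourier (V := Rn d) (W := Rn d)).toLinearMap

/-- The linear change of variables `(x, t) ↦ (t - x, -(t + x) / 2)`. -/
def kernelEquiv (d : ℕ) : Phase d ≃L[ℝ] Phase d :=
  (ContinuousLinearEquiv.prodComm ℝ (Rn d) (Rn d)).trans (kernelCoords d).symm

/-- Composition with `(x, t) ↦ (t - x, -(t + x) / 2)`. -/
def kernelOp (d : ℕ) : SchwartzEnd d :=
  (compCLMOfContinuousLinearEquiv ℂ (kernelEquiv d)).toLinearMap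

lemma kernelCoords_symm_apply (t x : Rn d) :
    (kernelCoords d).symm (t, x) = (t - x, -(2⁻¹ : ℝ) • (t + x)) := rfl

lemma kernelEquiv_apply (x t : Rn d) :
    kernelEquiv d (x, t) = (t - x, -(2⁻¹ : ℝ) • (t + x)) := rfl

lemma fourierOp_apply (F : 𝓢(Phase d, ℂ)) (x η : Rn d) :
    fourierOp d F (x, η) = 𝓕 (slice x F) η := partialFourierFun_eq F (x, η)

lemma kernelOp_apply (F : 𝓢(Phase d, ℂ)) (z : Phase d) :
    kernelOp d F z = F (kernelEquiv d z) := rfl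

lemma coordOp_fst_mul_fourierOp (j : Fin d) :
    coordOp (Sum.inl j) * fourierOp d = fourierOp d * coordOp (Sum.inl j) := by
  ext F ⟨x, η⟩
  change coordOp (Sum.inl j) (fourierOp d F) (x, η) = fourierOp d (coordOp (Sum.inl j) F) (x, η)
  have h : slice x (coordOp (Sum.inl j) F) = (x j : ℂ) • slice x F := by
    ext ξ
    rw [slice_apply, coordOp_apply]; rfl
  rw [coordOp_apply, fourierOp_apply, fourierOp_apply, h, FourierTransform.fourier_smul]
  rfl

lemma coordOp_snd_mul_fourierOp (j : Fin d) :
    coordOp (Sum.inr j) * fourierOp d =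
      fourierOp d * ((2 * π * Complex.I)⁻¹ • derivOp (Sum.inr j)) := by
  ext F ⟨x, η⟩
  change coordOp (Sum.inr j) (fourierOp d F) (x, η) =
    fourierOp d ((2 * π * Complex.I)⁻¹ • derivOp (Sum.inr j) F) (x, η)
  have h : slice x (derivOp (Sum.inr j) F) =
      ∂_{EuclideanSpace.single j (1 : ℝ)} (slice x F) := by
    ext ξ
    rw [slice_apply, derivOp_apply, lineDerivOp_apply_eq_fderiv]
    have h1 : HasFDerivAt (fun ξ : Rn d => (x, ξ)) (ContinuousLinearMap.inr ℝ (Rn d) (Rn d)) ξ :=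
      hasFDerivAt_prodMk_right x ξ
    have h2 : HasFDerivAt (slice x F) ((fderiv ℝ F (x, ξ)).comp
        (ContinuousLinearMap.inr ℝ (Rn d) (Rn d))) ξ := (F.hasFDerivAt (x, ξ)).comp ξ h1
    rw [h2.fderiv]; rfl
  have ht : Function.HasTemperateGrowth
      fun y : Rn d => ⟪y, EuclideanSpace.single j (1 : ℝ)⟫_ℝ := by fun_prop
  have h0 : (2 * π * Complex.I : ℂ) ≠ 0 := Complex.two_pi_I_ne_zero
  rw [coordOp_apply, fourierOp_apply, map_smul, smul_apply, fourierOp_apply, h,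
    fourier_lineDerivOp_eq, smul_apply, smulLeftCLM_apply_apply ht, smul_smul,
    inv_mul_cancel₀ h0, one_smul]
  simp [phaseCoord, EuclideanSpace.inner_single_right]

lemma derivOp_fourierOp_apply (i : Fin d ⊕ Fin d) (F : 𝓢(Phase d, ℂ)) (z : Phase d) :
    derivOp i (fourierOp d F) z =
      ∫ ξ : Rn d, 𝐞 (-⟪ξ, z.2⟫_ℝ) • (fderiv ℝ F (z.1, ξ) ((phaseBasis d i).1, 0) +
        (-(2 * π * Complex.I) : ℂ) • (⟪ξ, (phaseBasis d i).2⟫_ℝ • F (z.1, ξ))) := by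
  have h := (partialFourier_hasFDerivAt F z).fderiv
  rw [derivOp_apply]
  change fderiv ℝ (partialFourierFun F) z (phaseBasis d i) = _
  rw [h, partialFourierFun, ContinuousLinearMap.integral_apply
    (partialFourier_integrable (partialFourierDeriv F) z)]
  refine integral_congr_ae (Filter.Eventually.of_forall fun ξ => ?_)
  exact congrArg (𝐞 (-⟪ξ, z.2⟫_ℝ) • ·) (partialFourierDeriv_apply F (z.1, ξ) (phaseBasis d i))

lemma fourierOp_eq_integral (F : 𝓢(Phase d, ℂ)) (z : Phase d) :
    fourierOp d F z = ∫ ξ : Rn d, 𝐞 (-⟪ξ, z.2⟫_ℝ) • F (z.1, ξ) := rfl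

lemma derivOp_fst_mul_fourierOp (j : Fin d) :
    derivOp (Sum.inl j) * fourierOp d = fourierOp d * derivOp (Sum.inl j) := by
  ext F z
  change derivOp (Sum.inl j) (fourierOp d F) z = fourierOp d (derivOp (Sum.inl j) F) z
  rw [derivOp_fourierOp_apply, fourierOp_eq_integral]
  simp [phaseBasis, derivOp_apply]

lemma derivOp_snd_mul_fourierOp (j : Fin d) :
    derivOp (Sum.inr j) * fourierOp d =
      fourierOp d * ((-(2 * π * Complex.I) : ℂ) • coordOp (Sum.inr j)) := by
  ext F z
  change derivOp (Sum.inr j) (fourierOp d F) z =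
    fourierOp d ((-(2 * π * Complex.I) : ℂ) • coordOp (Sum.inr j) F) z
  rw [derivOp_fourierOp_apply, fourierOp_eq_integral]
  simp only [smul_apply, coordOp_apply]
  refine integral_congr_ae (Filter.Eventually.of_forall fun ξ => ?_)
  have h0 : ((phaseBasis d (Sum.inr j)).1, (0 : Rn d)) = 0 := rfl
  have h1 : ⟪ξ, (phaseBasis d (Sum.inr j)).2⟫_ℝ = ξ j := by
    simp [phaseBasis, EuclideanSpace.inner_single_right]
  simp only [h0, map_zero, zero_add, h1, phaseCoord, Complex.real_smul, smul_eq_mul]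

/-- With `p = t - x` and `q = -(t + x) / 2` one has `t = p / 2 - q`. -/
lemma coordOp_snd_mul_kernelOp (j : Fin d) :
    coordOp (Sum.inr j) * kernelOp d =
      kernelOp d * ((2⁻¹ : ℂ) • coordOp (Sum.inl j) - coordOp (Sum.inr j)) := by
  ext F ⟨x, t⟩
  change coordOp (Sum.inr j) (kernelOp d F) (x, t) =
    (2⁻¹ : ℂ) * (coordOp (Sum.inl j) F) (kernelEquiv d (x, t)) -
      (coordOp (Sum.inr j) F) (kernelEquiv d (x, t))
  rw [coordOp_apply, coordOp_apply, coordOp_apply, kernelOp_apply, kernelEquiv_apply]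
  simp only [phaseCoord, PiLp.sub_apply, PiLp.smul_apply, PiLp.add_apply, smul_eq_mul]
  push_cast
  ring

/-- Chain rule: moving `t` in direction `e_j` moves `(p, q)` by `(e_j, -e_j / 2)`. -/
lemma derivOp_snd_mul_kernelOp (j : Fin d) :
    derivOp (Sum.inr j) * kernelOp d =
      kernelOp d * (derivOp (Sum.inl j) - (2⁻¹ : ℂ) • derivOp (Sum.inr j)) := by
  ext F z
  change (∂_{phaseBasis d (Sum.inr j)}
    (compCLMOfContinuousLinearEquiv ℂ (kernelEquiv d) F)) z =
      derivOp (Sum.inl j) F (kernelEquiv d z) -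
        (2⁻¹ : ℂ) * derivOp (Sum.inr j) F (kernelEquiv d z)
  rw [lineDerivOp_compCLMOfContinuousLinearEquiv]
  change fderiv ℝ F (kernelEquiv d z) (kernelEquiv d (0, EuclideanSpace.single j 1)) =
    fderiv ℝ F (kernelEquiv d z) (EuclideanSpace.single j 1, 0) -
      (2⁻¹ : ℂ) * fderiv ℝ F (kernelEquiv d z) (0, EuclideanSpace.single j 1)
  have h : kernelEquiv d (0, EuclideanSpace.single j 1) =
      (EuclideanSpace.single j 1, 0) - (2⁻¹ : ℝ) • (0, EuclideanSpace.single j 1) := by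
    rw [kernelEquiv_apply]; simp
  rw [h, map_sub, map_smul, Complex.real_smul]
  simp

/-- The passage from a function `F` to the kernel `(x, t) ↦ (F^ξ F) (t - x, -(t + x) / 2)`. -/
def toKernelOp (d : ℕ) : SchwartzEnd d := kernelOp d * fourierOp d

/-- The operator corresponding to multiplication of kernels by `t_j`. -/
def positionOp (j : Fin d) : SchwartzEnd d :=
  (2⁻¹ : ℂ) • coordOp (Sum.inl j) - (2 * π * Complex.I)⁻¹ • derivOp (Sum.inr j)

/-- The operator corresponding to differentiation of kernels with respect to `t_j`, up to the
factor `2 π i`. -/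
def momentumOp (j : Fin d) : SchwartzEnd d :=
  (2 * π * Complex.I : ℂ)⁻¹ • derivOp (Sum.inl j) + (2⁻¹ : ℂ) • coordOp (Sum.inr j)

lemma semiconj_position (j : Fin d) :
    SemiconjBy (toKernelOp d) (positionOp j) (coordOp (Sum.inr j)) := by
  rw [SemiconjBy, toKernelOp, ← mul_assoc, coordOp_snd_mul_kernelOp, mul_assoc, mul_assoc]
  congr 1
  rw [sub_mul, smul_mul_assoc, coordOp_fst_mul_fourierOp, coordOp_snd_mul_fourierOp, positionOp,
    mul_sub, mul_smul_comm]

lemma semiconj_momentum (j : Fin d) :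
    SemiconjBy (toKernelOp d) (momentumOp j) ((2 * π * Complex.I : ℂ)⁻¹ • derivOp (Sum.inr j)) := by
  have h0 : (2 * π * Complex.I : ℂ) ≠ 0 := Complex.two_pi_I_ne_zero
  have h1 : (2 * π * Complex.I : ℂ)⁻¹ •
      ((derivOp (Sum.inl j) - (2⁻¹ : ℂ) • derivOp (Sum.inr j)) * fourierOp d) =
      fourierOp d * momentumOp j := by
    rw [sub_mul, smul_mul_assoc, derivOp_fst_mul_fourierOp, derivOp_snd_mul_fourierOp, momentumOp,
      mul_add, mul_smul_comm, mul_smul_comm, mul_smul_comm, smul_sub, smul_smul, smul_smul,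
      sub_eq_add_neg, ← neg_smul]
    congr 2
    field_simp
  rw [SemiconjBy, toKernelOp, mul_assoc, ← h1, mul_smul_comm, smul_mul_assoc, ← mul_assoc,
    ← mul_assoc, derivOp_snd_mul_kernelOp]

lemma semiconj_fourier (j : Fin d) :
    SemiconjBy (fourierOp d) ((2 * π * Complex.I : ℂ)⁻¹ • derivOp (Sum.inr j))
      (coordOp (Sum.inr j)) :=
  (coordOp_snd_mul_fourierOp j).symm

/-- The operator `(1 + ∑ X_j ²) ^ m`. -/
def bracketOp (m : ℕ) (X : Fin d → SchwartzEnd d) : SchwartzEnd d := (1 + ∑ j, X j ^ 2) ^ m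

lemma semiconj_bracketOp {U : SchwartzEnd d} {X X' : Fin d → SchwartzEnd d}
    (h : ∀ j, SemiconjBy U (X j) (X' j)) (m : ℕ) :
    SemiconjBy U (bracketOp m X) (bracketOp m X') := by
  refine SemiconjBy.pow_right ?_ m
  refine (SemiconjBy.one_right U).add_right ?_
  rw [SemiconjBy, Finset.mul_sum, Finset.sum_mul]
  exact Finset.sum_congr rfl fun j _ => (h j).pow_right 2

lemma hasOrder_bracketOp {X : Fin d → SchwartzEnd d} (h : ∀ j, HasOrder 1 (X j)) (m : ℕ) :
    HasOrder (2 * m) (bracketOp m X) := by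
  have h1 : HasOrder 2 (1 + ∑ j, X j ^ 2) :=
    (HasOrder.one.mono (by norm_num)).add (HasOrder.sum _ fun j _ => (h j).pow 2)
  rw [mul_comm]
  exact h1.pow m

lemma bracketOp_coordOp_apply (m : ℕ) (F : 𝓢(Phase d, ℂ)) (z : Phase d) :
    bracketOp m (fun j => coordOp (Sum.inr j)) F z = ((1 + ‖z.2‖ ^ 2) ^ m : ℝ) * F z := by
  have h1 : ∀ G : 𝓢(Phase d, ℂ), (1 + ∑ j : Fin d, coordOp (Sum.inr j) ^ 2 : SchwartzEnd d) G z =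
      (1 + ‖z.2‖ ^ 2 : ℝ) * G z := by
    intro G
    rw [LinearMap.add_apply, LinearMap.sum_apply, add_apply, sum_apply]
    simp only [coordOp_pow_apply, Module.End.one_apply, phaseCoord]
    rw [← Finset.sum_mul, EuclideanSpace.norm_sq_eq]
    push_cast
    simp only [Real.norm_eq_abs, ← Complex.ofReal_pow, sq_abs]
    ring
  unfold bracketOp
  induction m with
  | zero => simp
  | succ m ih =>
    rw [pow_succ', Module.End.mul_apply, h1, ih]
    push_cast
    ring

lemma positionOp_hasOrder (j : Fin d) : HasOrder 1 (positionOp j) := by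
  rw [positionOp, sub_eq_add_neg, ← neg_smul]
  exact ((hasOrder_coordOp _).smul _).add ((hasOrder_derivOp _).smul _)

lemma momentumOp_hasOrder (j : Fin d) : HasOrder 1 (momentumOp j) :=
  ((hasOrder_derivOp _).smul _).add ((hasOrder_coordOp _).smul _)

/-- The partial Fourier transform in `t` of `(1 + |t|²) ^ m` times the kernel of `Φ`. -/
def weightedKernel (m : ℕ) (Φ : 𝓢(Phase d, ℂ)) : 𝓢(Phase d, ℂ) :=
  fourierOp d (bracketOp m (fun j => coordOp (Sum.inr j)) (toKernelOp d Φ))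

/-- The weight in `τ` passes through the Fourier transform in `t` as a bracket of the derivatives
`(2πi)⁻¹ ∂_t`. Both this bracket and the weight in `t` then pass through the kernel map onto `Φ`, as
brackets of first-order momentum and position operators. -/
lemma bracketOp_weightedKernel (m : ℕ) (Φ : 𝓢(Phase d, ℂ)) :
    bracketOp m (fun j => coordOp (Sum.inr j)) (weightedKernel m Φ) =
      fourierOp d (kernelOp d (fourierOp d
        ((bracketOp m momentumOp * bracketOp m positionOp : SchwartzEnd d) Φ))) := by
  have h1 := semiconj_bracketOp (semiconj_fourier (d := d)) m
  have h2 := semiconj_bracketOp (semiconj_momentum (d := d)) m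
  have h3 := semiconj_bracketOp (semiconj_position (d := d)) m
  have e : bracketOp m (fun j => coordOp (Sum.inr j)) * (fourierOp d *
      (bracketOp m (fun j => coordOp (Sum.inr j)) * toKernelOp d)) =
      fourierOp d * (toKernelOp d * (bracketOp m momentumOp * bracketOp m positionOp)) := by
    rw [← mul_assoc, ← h1.eq, mul_assoc, ← h3.eq, ← mul_assoc _ (toKernelOp d), ← h2.eq, mul_assoc]
  exact LinearMap.congr_fun e Φ

end Intertwining

/-! ### Norm bounds for the symbol-to-kernel maps and the weighted kernel estimate -/

section Isometries

variable {d : ℕ}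

lemma lintegral_fourierOp_sq_le (F : 𝓢(Phase d, ℂ)) :
    ∫⁻ z, ‖fourierOp d F z‖ₑ ^ (2 : ℝ) ≤ ∫⁻ z, ‖F z‖ₑ ^ (2 : ℝ) := by
  rw [Measure.volume_eq_prod,
    lintegral_prod _ ((fourierOp d F).continuous.enorm.measurable.pow_const _).aemeasurable,
    lintegral_prod _ (F.continuous.enorm.measurable.pow_const _).aemeasurable]
  refine lintegral_mono fun x => ?_
  simp only [fourierOp_apply]
  rw [SchwartzMap.fourier_coe]
  exact lintegral_fourier_sq_le (slice x F).integrable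

lemma measurePreserving_kernelCoords_symm (d : ℕ) :
    MeasurePreserving (kernelCoords d).symm := by
  -- The map factors as `(t, x) ↦ (t - x, x)` followed by `(p, x) ↦ (p, -x - p / 2)`: a shear, then
  -- a shear combined with a reflection.
  have h1 : MeasurePreserving (fun z : Phase d => (z.1, -z.2 - (2⁻¹ : ℝ) • z.1)) := by
    refine MeasurePreserving.skew_product (g := fun p q => -q - (2⁻¹ : ℝ) • p)
      (MeasurePreserving.id volume) ?_ (Filter.Eventually.of_forall fun p => ?_)
    · exact Continuous.measurable (by fun_prop)
    · exact ((measurePreserving_sub_right volume ((2⁻¹ : ℝ) • p)).comp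
        (Measure.measurePreserving_neg volume)).map_eq
  have h2 : MeasurePreserving (fun z : Phase d => (z.1 - z.2, z.2)) :=
    measurePreserving_sub_prod volume volume
  have h3 := h1.comp h2
  convert h3 using 1
  funext ⟨t, x⟩
  rw [kernelCoords_symm_apply]
  ext i
  · rfl
  · simp; ring

lemma measurePreserving_kernelEquiv (d : ℕ) : MeasurePreserving (kernelEquiv d) :=
  (measurePreserving_kernelCoords_symm d).comp Measure.measurePreserving_swap

lemma lintegral_kernelOp_sq (F : 𝓢(Phase d, ℂ)) :
    ∫⁻ z, ‖kernelOp d F z‖ₑ ^ (2 : ℝ) = ∫⁻ z, ‖F z‖ₑ ^ (2 : ℝ) :=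
  (measurePreserving_kernelEquiv d).lintegral_comp (f := fun z => ‖F z‖ₑ ^ (2 : ℝ))
    (F.continuous.enorm.measurable.pow_const _)

/-- Two brackets of order `2 * m` act on `Φ`, whence the condition on `4 * m`. Around them stand two
fibrewise Fourier transforms and a measure-preserving substitution, none of which increases the `L²`
norm. -/
theorem exists_weightedKernel_bound (d m : ℕ) (hm : 4 * m ≤ 4 * d + 2) :
    ∃ C : NNReal, ∀ Φ : 𝓢(Phase d, ℂ),
      (∫⁻ z : Phase d, ‖(((1 + ‖z.2‖ ^ 2) ^ m : ℝ) : ℂ) * weightedKernel m Φ z‖ₑ ^ (2 : ℝ)) ^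
        (1 / 2 : ℝ) ≤ C * weightedNorm (4 * d + 2) Φ := by
  have h := ((hasOrder_bracketOp (positionOp_hasOrder (d := d)) m))
  have h' := ((hasOrder_bracketOp (momentumOp_hasOrder (d := d)) m)).mul h
  obtain ⟨C, hC⟩ := eLpNorm_le_weightedNorm
    (orderedSpan_mono (by omega : 2 * m + 2 * m ≤ 4 * d + 2) h'.mem_orderedSpan)
  refine ⟨C, fun Φ => le_trans ?_ (hC Φ)⟩
  simp only [← bracketOp_coordOp_apply, bracketOp_weightedKernel]
  rw [eLpNorm_eq_lintegral_rpow_enorm_toReal (by norm_num) (by norm_num), ENNReal.toReal_ofNat]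
  refine ENNReal.rpow_le_rpow ?_ (by norm_num)
  refine (lintegral_fourierOp_sq_le _).trans ?_
  rw [lintegral_kernelOp_sq]
  exact lintegral_fourierOp_sq_le _

end Isometries

end WeylCalc
end
noncomputable section
namespace WeylCalc

/-! ### The matrix coefficients of the quantization of a convolution -/

section WeakFormula

variable {d : ℕ}

lemma exp_neg_eq_char (r : ℝ) : Complex.exp (-(2 * π * Complex.I * r)) = (𝐞 (-r) : ℂ) := by
  rw [Real.fourierChar_apply]; congr 1; push_cast; ring

lemma symplecticFourier_eq (F : 𝓢(Phase d, ℂ)) (w : Phase d) :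
    symplecticFourier d F w = ∫ z, (𝐞 (-symplecticForm w z) : ℂ) * F z := by
  rw [symplecticFourier_apply]
  simp only [exp_neg_eq_char]

lemma continuous_symplecticForm : Continuous fun q : Phase d × Phase d =>
    symplecticForm q.1 q.2 := by
  unfold symplecticForm; fun_prop

/-- The dual form of `F_σ (a * φ) = F_σ a · F_σ φ`: Fubini, then the substitution `z ↦ z + w`, using
`σ(z, ζ) = σ(w, ζ) - σ(ζ, z - w)`. The reflection in the distributional transform accounts for the
sign of the character. -/
lemma correlation_symplecticFourier (φ A : 𝓢(Phase d, ℂ)) (w : Phase d) :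
    correlation φ (reflect d (symplecticFourier d A)) w =
      ∫ ζ, (𝐞 (symplecticForm w ζ) : ℂ) * symplecticFourier d φ ζ * A ζ := by
  rw [correlation_apply]
  have h1 : ∀ z, reflect d (symplecticFourier d A) z =
      ∫ ζ, (𝐞 (symplecticForm z ζ) : ℂ) * A ζ := fun z => by
    change symplecticFourier d A (-z) = _
    rw [symplecticFourier_eq]
    have h : ∀ ζ, -symplecticForm (-z) ζ = symplecticForm z ζ := fun ζ => by
      simp only [symplecticForm, Prod.fst_neg, Prod.snd_neg, inner_neg_left, inner_neg_right]
      ring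
    simp only [h]
  simp only [h1, ← integral_const_mul]
  rw [integral_integral_swap]
  · refine integral_congr_ae (Filter.Eventually.of_forall fun ζ => ?_)
    have h2 : ∀ z, φ (z - w) * ((𝐞 (symplecticForm z ζ) : ℂ) * A ζ) =
        (fun z => ((𝐞 (symplecticForm w ζ) : ℂ) * A ζ) *
          ((𝐞 (-symplecticForm ζ z) : ℂ) * φ z)) (z - w) := fun z => by
      have : (𝐞 (symplecticForm z ζ) : ℂ) =
          𝐞 (symplecticForm w ζ) * 𝐞 (-symplecticForm ζ (z - w)) := by
        rw [← Circle.coe_mul, ← AddChar.map_add_eq_mul]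
        congr 2
        simp only [symplecticForm, Prod.fst_sub, Prod.snd_sub, inner_sub_left, inner_sub_right]
        ring
      rw [this]; ring
    simp only [h2]
    rw [integral_sub_right_eq_self (μ := (volume : Measure (Phase d)))
      (fun z => ((𝐞 (symplecticForm w ζ) : ℂ) * A ζ) * ((𝐞 (-symplecticForm ζ z) : ℂ) * φ z)) w,
      integral_const_mul, ← symplecticFourier_eq]
    ring
  · have hφ : Integrable (fun z => φ (z - w)) (volume : Measure (Phase d)) :=
      φ.integrable.comp_sub_right w
    refine (hφ.mul_prod A.integrable).mono ?_ (Filter.Eventually.of_forall fun q => ?_)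
    · have := continuous_symplecticForm (d := d)
      refine Continuous.aestronglyMeasurable ?_
      simp only [Function.uncurry_def]
      refine (φ.continuous.comp (by fun_prop)).mul (Continuous.mul ?_
        (A.continuous.comp continuous_snd))
      fun_prop
    · simp only [Function.uncurry_def, norm_mul, Circle.norm_coe, one_mul, le_refl]

/-- Since `σ(w, (x, ξ)) = x · w.2 - w.1 · ξ`, the character is a constant phase times a modulation
in `ξ`, which the Fourier transform turns into a translation by `w.1`. -/
lemma fourier_modulated (F : 𝓢(Phase d, ℂ)) (w : Phase d) (x q : Rn d) :
    𝓕 (fun ξ => (𝐞 (symplecticForm w (x, ξ)) : ℂ) * F (x, ξ)) q =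
      (𝐞 ⟪x, w.2⟫_ℝ : ℂ) * fourierOp d F (x, q + w.1) := by
  rw [Real.fourier_eq, fourierOp_eq_integral, ← integral_const_mul]
  refine integral_congr_ae (Filter.Eventually.of_forall fun ξ => ?_)
  simp only [Circle.smul_def, smul_eq_mul, ← mul_assoc, ← Circle.coe_mul,
    ← AddChar.map_add_eq_mul]
  congr 3
  simp only [symplecticForm, inner_add_right, real_inner_comm]
  ring

/-- The multiplication formula `∫ f̂ g = ∫ f ĝ` on each fibre, with the character absorbed by
`fourier_modulated`. -/
lemma integral_mul_fourierOp (F B : 𝓢(Phase d, ℂ)) (w : Phase d) :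
    ∫ ζ, (𝐞 (symplecticForm w ζ) : ℂ) * F ζ * partialFourier B ζ =
      ∫ z : Phase d, B z * ((𝐞 ⟪z.1, w.2⟫_ℝ : ℂ) * fourierOp d F (z.1, z.2 + w.1)) := by
  have hc : Continuous fun ζ : Phase d => (𝐞 (symplecticForm w ζ) : ℂ) := by
    have : Continuous fun ζ : Phase d => symplecticForm w ζ :=
      continuous_symplecticForm.comp (by fun_prop : Continuous fun ζ : Phase d => (w, ζ))
    fun_prop
  have i1 : Integrable (fun ζ => (𝐞 (symplecticForm w ζ) : ℂ) * F ζ * partialFourier B ζ)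
      ((volume : Measure (Rn d)).prod (volume : Measure (Rn d))) := by
    obtain ⟨C, hC⟩ := F.toBoundedContinuousFunction.bddAbove_range_norm_comp
    refine ((partialFourier B).integrable (μ := (volume : Measure (Phase d)))).bdd_mul
      (c := C) (hc.mul F.continuous).aestronglyMeasurable (Filter.Eventually.of_forall fun z => ?_)
    rw [norm_mul, Circle.norm_coe, one_mul]
    exact hC ⟨z, rfl⟩
  have i2 : Integrable (fun z : Phase d => B z * ((𝐞 ⟪z.1, w.2⟫_ℝ : ℂ) *
      fourierOp d F (z.1, z.2 + w.1)))
      ((volume : Measure (Rn d)).prod (volume : Measure (Rn d))) := by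
    obtain ⟨C, hC⟩ := (fourierOp d F).toBoundedContinuousFunction.bddAbove_range_norm_comp
    refine (B.integrable (μ := (volume : Measure (Phase d)))).mul_bdd
      (c := C) ?_ (Filter.Eventually.of_forall fun z => ?_)
    · refine Continuous.aestronglyMeasurable (Continuous.mul (by fun_prop) ?_)
      exact (fourierOp d F).continuous.comp (by fun_prop)
    rw [norm_mul, Circle.norm_coe, one_mul]
    exact hC ⟨(z.1, z.2 + w.1), rfl⟩
  rw [Measure.volume_eq_prod, integral_prod _ i1, integral_prod _ i2]
  refine integral_congr_ae (Filter.Eventually.of_forall fun x => ?_)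
  have hg : Integrable fun ξ : Rn d => (𝐞 (symplecticForm w (x, ξ)) : ℂ) * F (x, ξ) := by
    refine (slice x F).integrable.bdd_mul (c := 1) ?_ (Filter.Eventually.of_forall fun ξ => ?_)
    · exact (hc.comp (by fun_prop : Continuous fun ξ : Rn d => (x, ξ))).aestronglyMeasurable
    · rw [Circle.norm_coe]
  have h := VectorFourier.integral_fourierIntegral_smul_eq_flip (L := innerₗ (Rn d))
      (μ := volume) (ν := volume) (f := slice x B)
      (g := fun ξ : Rn d => (𝐞 (symplecticForm w (x, ξ)) : ℂ) * F (x, ξ))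
      Real.continuous_fourierChar (innerSL ℝ (E := Rn d)).continuous₂ (slice x B).integrable hg
  rw [flip_innerₗ] at h
  have e1 : ∀ ξ, partialFourier B (x, ξ) = VectorFourier.fourierIntegral 𝐞 volume (innerₗ (Rn d))
    (slice x B) ξ := fun ξ => rfl
  have e2 : ∀ q, VectorFourier.fourierIntegral 𝐞 volume (innerₗ (Rn d))
      (fun ξ : Rn d => (𝐞 (symplecticForm w (x, ξ)) : ℂ) * F (x, ξ)) q =
      (𝐞 ⟪x, w.2⟫_ℝ : ℂ) * fourierOp d F (x, q + w.1) := fun q => fourier_modulated F w x q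
  simp only [e1]
  simp only [e2, smul_eq_mul, slice_apply] at h
  rw [← h]
  exact integral_congr_ae (Filter.Eventually.of_forall fun ξ => mul_comm _ _)

/-- The value at `w` is the matrix coefficient of `π(w) L_φ π(w)*`: translating `x` and `t` by `w.1`
fixes `t - x` and shifts `-(t + x) / 2` by `w.1`, while the modulations leave the phase in `t - x`.
-/
lemma weyl_kernel_formula (φ : 𝓢(Phase d, ℂ)) (ψ χ : 𝓢(Rn d, ℂ)) (w : Phase d) :
    correlation φ (reflect d (symplecticFourier d (partialFourier
      (compCLMOfContinuousLinearEquiv ℂ (kernelCoords d) (tensorLeft ψ χ))))) w =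
      ∫ z : Phase d, ψ z.1 * χ z.2 * ((𝐞 ⟪z.2 - z.1, w.2⟫_ℝ : ℂ) *
        toKernelOp d (symplecticFourier d φ) (z.1 - w.1, z.2 - w.1)) := by
  rw [correlation_symplecticFourier, integral_mul_fourierOp,
    ← (measurePreserving_kernelEquiv d).integral_comp
      (kernelEquiv d).toHomeomorph.measurableEmbedding]
  refine integral_congr_ae (Filter.Eventually.of_forall fun z => ?_)
  obtain ⟨x, t⟩ := z
  have h1 : (compCLMOfContinuousLinearEquiv ℂ (kernelCoords d) (tensorLeft ψ χ))
      (kernelEquiv d (x, t)) = ψ x * χ t := by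
    change (tensorLeft ψ χ) (kernelCoords d ((kernelCoords d).symm (t, x))) = _
    rw [ContinuousLinearEquiv.apply_symm_apply, tensorLeft_apply, mul_comm]
  have h2 : toKernelOp d (symplecticFourier d φ) (x - w.1, t - w.1) =
      fourierOp d (symplecticFourier d φ) ((kernelEquiv d (x, t)).1,
        (kernelEquiv d (x, t)).2 + w.1) := by
    change fourierOp d (symplecticFourier d φ) (kernelEquiv d (x - w.1, t - w.1)) = _
    congr 1
    rw [kernelEquiv_apply, kernelEquiv_apply]
    ext i
    · simp
    · simp; ring
  dsimp only
  rw [h1, h2]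
  rfl

/-- The weight `(1 + |t|²) ^ (-m)`. -/
def decay (m : ℕ) (t : Rn d) : ℝ := ((1 + ‖t‖ ^ 2) ^ m)⁻¹

lemma continuous_decay (m : ℕ) : Continuous (decay m : Rn d → ℝ) := by
  unfold decay
  exact Continuous.inv₀ (by fun_prop) fun t => by positivity

lemma decay_pos (m : ℕ) (t : Rn d) : 0 < decay m t := by unfold decay; positivity

lemma decay_le_one (m : ℕ) (t : Rn d) : decay m t ≤ 1 := by
  unfold decay
  exact inv_le_one_of_one_le₀ (one_le_pow₀ (by nlinarith [sq_nonneg ‖t‖]))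

/-- Fourier inversion in `t` for the weighted kernel, with the weight divided out again. The weight
buys square integrability of the factor depending on `t`. -/
lemma toKernelOp_eq (m : ℕ) (Φ : 𝓢(Phase d, ℂ)) (x t : Rn d) :
    toKernelOp d Φ (x, t) =
      decay m t * ∫ τ, (𝐞 ⟪τ, t⟫_ℝ : ℂ) * weightedKernel m Φ (x, τ) := by
  set G := bracketOp m (fun j => coordOp (Sum.inr j)) (toKernelOp d Φ)
  have h1 : 𝓕⁻ (𝓕 (slice x G)) t = G (x, t) := by
    rw [FourierTransform.fourierInv_fourier_eq]; rfl
  rw [SchwartzMap.fourierInv_coe, Real.fourierInv_eq] at h1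
  have h2 : G (x, t) = ((1 + ‖t‖ ^ 2) ^ m : ℝ) * toKernelOp d Φ (x, t) :=
    bracketOp_coordOp_apply m _ _
  have h3 : ∫ τ, (𝐞 ⟪τ, t⟫_ℝ : ℂ) * weightedKernel m Φ (x, τ) = G (x, t) := by
    rw [← h1]
    refine integral_congr_ae (Filter.Eventually.of_forall fun τ => ?_)
    simp only [Circle.smul_def, smul_eq_mul]
    rw [weightedKernel, fourierOp_apply]
  rw [h3, h2, ← mul_assoc, ← Complex.ofReal_mul, decay, inv_mul_cancel₀ (by positivity),
    Complex.ofReal_one, one_mul]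

/-- The family `t ↦ exp (2 π i t · τ) (1 + |t|²) ^ (-m)`. -/
def atomLeft (m : ℕ) (τ t : Rn d) : ℂ := (𝐞 ⟪τ, t⟫_ℝ : ℂ) * decay m t

/-- The complex conjugates of the slices of the weighted kernel. -/
def atomRight (m : ℕ) (Φ : 𝓢(Phase d, ℂ)) (τ x : Rn d) : ℂ :=
  starRingEnd ℂ (weightedKernel m Φ (x, τ))

/-- For each `τ` the integrand of `toKernelOp_eq` is a product of a function of `t` and one of `x`,
and the phase in `t - x` splits accordingly into the two shifts. Fubini then moves the integral over
`τ` outside. -/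
lemma weyl_separated (m : ℕ) (φ : 𝓢(Phase d, ℂ)) (ψ χ : 𝓢(Rn d, ℂ)) (w : Phase d) :
    correlation φ (reflect d (symplecticFourier d (partialFourier
      (compCLMOfContinuousLinearEquiv ℂ (kernelCoords d) (tensorLeft ψ χ))))) w =
      ∫ τ : Rn d, (∫ t, χ t * tfShift w (atomLeft m τ) t) *
        (∫ x, starRingEnd ℂ (tfShift w (atomRight m (symplecticFourier d φ) τ) x) * ψ x) := by
  set Φ := symplecticFourier d φ
  rw [weyl_kernel_formula]
  have h1 : ∀ z : Phase d, ψ z.1 * χ z.2 * ((𝐞 ⟪z.2 - z.1, w.2⟫_ℝ : ℂ) *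
      toKernelOp d Φ (z.1 - w.1, z.2 - w.1)) =
      ∫ τ, (starRingEnd ℂ (tfShift w (atomRight m Φ τ) z.1) * ψ z.1) *
        (χ z.2 * tfShift w (atomLeft m τ) z.2) := fun z => by
    rw [toKernelOp_eq m, ← integral_const_mul, ← integral_const_mul, ← integral_const_mul]
    refine integral_congr_ae (Filter.Eventually.of_forall fun τ => ?_)
    beta_reduce
    rw [conj_tfShift_mul, tfShift, atomLeft, atomRight, Circle.smul_def, Circle.smul_def,
      smul_eq_mul, smul_eq_mul, RCLike.conj_conj, inner_sub_left, sub_eq_neg_add,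
      AddChar.map_add_eq_mul, Circle.coe_mul]
    ring
  rw [integral_congr_ae (Filter.Eventually.of_forall h1), integral_integral_swap]
  · refine integral_congr_ae (Filter.Eventually.of_forall fun τ => ?_)
    beta_reduce
    rw [Measure.volume_eq_prod, integral_prod_mul
      (fun x => starRingEnd ℂ (tfShift w (atomRight m Φ τ) x) * ψ x)
      (fun t => χ t * tfShift w (atomLeft m τ) t), mul_comm]
  -- The majorant uses that the weighted kernel decays in `τ` uniformly in `x`, and that the left
  -- atom is bounded by `1`.
  · obtain ⟨l, hl⟩ := (inferInstance :
      (volume : Measure (Rn d)).HasTemperateGrowth).exists_integrable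
    obtain ⟨C, hC⟩ := schwartz_snd_decay (weightedKernel m Φ) l
    have hD : Integrable (fun q : Phase d × Rn d =>
        (ψ q.1.1 * χ q.1.2) * (C * (1 + ‖q.2‖) ^ (-(l : ℝ)) : ℝ))
        ((volume : Measure (Phase d)).prod (volume : Measure (Rn d))) := by
      have h2 : Integrable (fun z : Phase d => ψ z.1 * χ z.2) (volume : Measure (Phase d)) :=
        ψ.integrable.mul_prod χ.integrable
      exact h2.mul_prod (hl.const_mul C).ofReal
    refine hD.mono ?_ (Filter.Eventually.of_forall fun q => ?_)
    · refine Continuous.aestronglyMeasurable ?_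
      simp only [Function.uncurry_def, tfShift, atomLeft, atomRight, Circle.smul_def]
      have c1 : Continuous fun q : Phase d × Rn d => weightedKernel m Φ (q.1.1 - w.1, q.2) :=
        (weightedKernel m Φ).continuous.comp (by fun_prop)
      have c2 : Continuous fun q : Phase d × Rn d => (decay m (q.1.2 - w.1) : ℂ) :=
        Complex.continuous_ofReal.comp ((continuous_decay m).comp (by fun_prop))
      have c3 : Continuous fun q : Phase d × Rn d => ψ q.1.1 := ψ.continuous.comp (by fun_prop)
      have c4 : Continuous fun q : Phase d × Rn d => χ q.1.2 := χ.continuous.comp (by fun_prop)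
      fun_prop
    · have e1 : ‖tfShift w (atomRight m Φ q.2) q.1.1‖ ≤ C * (1 + ‖q.2‖) ^ (-(l : ℝ)) := by
        rw [tfShift, Circle.norm_smul, atomRight, RCLike.norm_conj]
        exact hC _ _
      have e2 : ‖tfShift w (atomLeft m q.2) q.1.2‖ ≤ 1 := by
        rw [tfShift, Circle.norm_smul, atomLeft, norm_mul, Circle.norm_coe, one_mul,
          Complex.norm_real, Real.norm_of_nonneg (decay_pos _ _).le]
        exact decay_le_one _ _
      simp only [Function.uncurry_def, norm_mul, RCLike.norm_conj, Complex.norm_real]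
      calc _ ≤ ((C * (1 + ‖q.2‖) ^ (-(l : ℝ))) * ‖ψ q.1.1‖) * (‖χ q.1.2‖ * 1) := by
            gcongr
            exact mul_nonneg ((norm_nonneg _).trans e1) (norm_nonneg _)
        _ = ‖ψ q.1.1‖ * ‖χ q.1.2‖ * (C * (1 + ‖q.2‖) ^ (-(l : ℝ))) := by ring
        _ ≤ _ := by
            rw [← norm_mul C]
            gcongr
            exact Real.le_norm_self _

end WeakFormula

end WeylCalc
end
noncomputable section
namespace WeylCalc

/-! ### Schatten bounds for the quantization of a convolution -/

section Atoms

variable {d : ℕ}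

/-- The square is `(1 + |t|²) ^ (-2d)`, integrable on `ℝ^d` because `4 * d > d`. This fails to be
strict for `d = 0`, where the space is a point and compactness suffices. -/
lemma memLp_decay : MemLp (fun t : Rn d => (decay d t : ℂ)) 2 := by
  rcases Nat.eq_zero_or_pos d with rfl | hd
  · exact (Complex.continuous_ofReal.comp (continuous_decay 0)).memLp_of_hasCompactSupport
      (isCompact_univ.of_isClosed_subset (isClosed_tsupport _) (Set.subset_univ _))
  have hc : AEStronglyMeasurable (fun t : Rn d => (decay d t : ℂ)) volume :=
    (Complex.continuous_ofReal.comp (continuous_decay d)).aestronglyMeasurable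
  rw [memLp_two_iff_integrable_sq_norm hc]
  have h := integrable_rpow_neg_one_add_norm_sq (E := Rn d) (μ := volume) (r := (4 * d : ℝ)) (by
    rw [finrank_euclideanSpace_fin]
    have : (0 : ℝ) < d := by exact_mod_cast hd
    linarith)
  refine h.congr (Filter.Eventually.of_forall fun t => ?_)
  have e : -(4 * (d : ℝ)) / 2 = -((2 * d : ℕ) : ℝ) := by push_cast; ring
  beta_reduce
  rw [e, Real.rpow_neg (by positivity), Real.rpow_natCast, Complex.norm_real,
    Real.norm_of_nonneg (decay_pos _ _).le, decay, inv_pow, ← pow_mul, mul_comm d 2]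

lemma continuous_atomLeft (m : ℕ) :
    Continuous (Function.uncurry (atomLeft m : Rn d → Rn d → ℂ)) := by
  have h : Continuous fun q : Rn d × Rn d => (decay m q.2 : ℂ) :=
    Complex.continuous_ofReal.comp ((continuous_decay m).comp continuous_snd)
  simp only [Function.uncurry_def, atomLeft]
  fun_prop

lemma norm_atomLeft (m : ℕ) (τ t : Rn d) : ‖atomLeft m τ t‖ = ‖(decay m t : ℂ)‖ := by
  rw [atomLeft, norm_mul, Circle.norm_coe, one_mul]

lemma memLp_atomLeft (τ : Rn d) : MemLp (atomLeft d τ) 2 :=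
  memLp_decay.of_le
    ((continuous_atomLeft d).comp (by fun_prop : Continuous fun t : Rn d => (τ, t))).aestronglyMeasurable
    (Filter.Eventually.of_forall fun t => (norm_atomLeft d τ t).le)

lemma eLpNorm_atomLeft (τ : Rn d) :
    eLpNorm (atomLeft d τ) 2 volume = eLpNorm (fun t : Rn d => (decay d t : ℂ)) 2 volume :=
  eLpNorm_congr_norm_ae (Filter.Eventually.of_forall fun t => norm_atomLeft d τ t)

lemma continuous_atomRight (m : ℕ) (Φ : 𝓢(Phase d, ℂ)) :
    Continuous (Function.uncurry (atomRight m Φ)) := by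
  have h : Continuous fun q : Rn d × Rn d => weightedKernel m Φ (q.2, q.1) :=
    (weightedKernel m Φ).continuous.comp (by fun_prop)
  exact Complex.continuous_conj.comp h

lemma memLp_atomRight (m : ℕ) (Φ : 𝓢(Phase d, ℂ)) (τ : Rn d) : MemLp (atomRight m Φ τ) 2 := by
  have h : MemLp (slice τ (compCLMOfContinuousLinearEquiv ℂ
    (ContinuousLinearEquiv.prodComm ℝ (Rn d) (Rn d)) (weightedKernel m Φ))) 2 volume :=
    SchwartzMap.memLp _ 2 volume
  exact h.star

/-- The weighted kernel is square integrable against its weight. -/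
lemma weightedKernel_lintegral_ne_top (m : ℕ) (Φ : 𝓢(Phase d, ℂ)) :
    (∫⁻ z : Phase d, ‖(((1 + ‖z.2‖ ^ 2) ^ m : ℝ) : ℂ) * weightedKernel m Φ z‖ₑ ^ (2 : ℝ)) ^
      (1 / 2 : ℝ) ≠ ⊤ := by
  simp only [← bracketOp_coordOp_apply]
  rw [lintegral_enorm_sq_eq]
  exact ENNReal.rpow_ne_top_of_nonneg (by norm_num) (ENNReal.rpow_ne_top_of_nonneg (by norm_num)
    (SchwartzMap.memLp _ 2 volume).eLpNorm_ne_top)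

/-- The factor `1 = decay · weight` is inserted at each `τ`; Cauchy–Schwarz in `τ` then trades the
`L¹` integral of norms for a weighted `L²` norm on phase space. -/
lemma lintegral_eLpNorm_atomRight_le (m : ℕ) (Φ : 𝓢(Phase d, ℂ)) :
    ∫⁻ τ, eLpNorm (atomRight m Φ τ) 2 volume ≤
      eLpNorm (fun t : Rn d => (decay m t : ℂ)) 2 volume *
      (∫⁻ z : Phase d, ‖(((1 + ‖z.2‖ ^ 2) ^ m : ℝ) : ℂ) * weightedKernel m Φ z‖ₑ ^ (2 : ℝ)) ^
        (1 / 2 : ℝ) := by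
  set ρ : Rn d → ℂ := fun t => (((1 + ‖t‖ ^ 2) ^ m : ℝ) : ℂ)
  have hr : ∀ τ, eLpNorm (atomRight m Φ τ) 2 volume =
      ‖(decay m τ : ℂ)‖ₑ * eLpNorm (fun x => ρ τ * weightedKernel m Φ (x, τ)) 2 volume := fun τ => by
    have h1 : eLpNorm (atomRight m Φ τ) 2 volume =
        eLpNorm (fun x => weightedKernel m Φ (x, τ)) 2 volume :=
      eLpNorm_congr_norm_ae (Filter.Eventually.of_forall fun x => RCLike.norm_conj _)
    have h2 : (fun x => weightedKernel m Φ (x, τ)) =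
        (decay m τ : ℂ) • fun x => ρ τ * weightedKernel m Φ (x, τ) := by
      funext x
      rw [Pi.smul_apply, smul_eq_mul, ← mul_assoc, ← Complex.ofReal_mul, decay,
        inv_mul_cancel₀ (by positivity), Complex.ofReal_one, one_mul]
    rw [h1, h2, eLpNorm_const_smul]
  have hcont : Continuous fun q : Rn d × Rn d => ρ q.1 * weightedKernel m Φ (q.2, q.1) := by
    have : Continuous fun q : Rn d × Rn d => weightedKernel m Φ (q.2, q.1) :=
      (weightedKernel m Φ).continuous.comp (by fun_prop)
    fun_prop
  have hmeas : Measurable fun τ => eLpNorm (fun x => ρ τ * weightedKernel m Φ (x, τ)) 2 volume :=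
    measurable_eLpNorm (b := fun τ x => ρ τ * weightedKernel m Φ (x, τ)) hcont.measurable
  have hdec : Measurable fun τ : Rn d => ‖(decay m τ : ℂ)‖ₑ :=
    (Complex.continuous_ofReal.comp (continuous_decay m)).measurable.enorm
  simp only [hr]
  refine (ENNReal.lintegral_mul_le_Lp_mul_Lq volume Real.HolderConjugate.two_two
    hdec.aemeasurable hmeas.aemeasurable).trans ?_
  refine mul_le_mul' ?_ ?_
  · rw [eLpNorm_eq_lintegral_rpow_enorm_toReal (by norm_num) (by norm_num), ENNReal.toReal_ofNat]
  · refine ENNReal.rpow_le_rpow (le_of_eq ?_) (by norm_num)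
    have hs : ∀ τ, eLpNorm (fun x => ρ τ * weightedKernel m Φ (x, τ)) 2 volume ^ (2 : ℝ) =
        ∫⁻ x, ‖ρ τ * weightedKernel m Φ (x, τ)‖ₑ ^ (2 : ℝ) := fun τ =>
      (lintegral_enorm_sq_eq _).symm
    rw [lintegral_congr hs]
    have hcont' : Continuous fun z : Rn d × Rn d => ρ z.2 * weightedKernel m Φ z := by
      have : Continuous ρ := by fun_prop
      exact (this.comp continuous_snd).mul (weightedKernel m Φ).continuous
    have hm' : Measurable fun z : Rn d × Rn d => ‖ρ z.2 * weightedKernel m Φ z‖ₑ ^ (2 : ℝ) := by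
      have h0 := hcont'.measurable.enorm
      exact h0.pow_const (2 : ℝ)
    exact (lintegral_prod_symm (μ := (volume : Measure (Rn d))) (ν := (volume : Measure (Rn d)))
      _ hm'.aemeasurable).symm

end Atoms

/-! ### Identification of the superposition with the Weyl quantization -/

section Extension

variable {d : ℕ}

/-- The pairing of distributions is bilinear and the inner product conjugates its first slot, so the
test function enters through its complex conjugate. -/
lemma toTemperedDistribution_eq_inner (f : L2 d) (χ : 𝓢(Rn d, ℂ)) :
    Lp.toTemperedDistribution f χ = ⟪star (χ.toLp 2 volume), f⟫_ℂ := by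
  rw [Lp.toTemperedDistribution_apply, L2.inner_def]
  refine integral_congr_ae ?_
  filter_upwards [Lp.coeFn_star (χ.toLp 2 volume), χ.coeFn_toLp 2 volume] with t h1 h2
  rw [h1, Pi.star_apply, h2, RCLike.inner_apply, smul_eq_mul, mul_comm]
  simp

lemma inner_star_tfShiftLp {b : Rn d → ℂ} (hb : MemLp b 2) (w : Phase d) (χ : 𝓢(Rn d, ℂ)) :
    ⟪star (χ.toLp 2 volume), tfShiftLp hb w⟫_ℂ = ∫ t, χ t * tfShift w b t := by
  rw [L2.inner_def]
  refine integral_congr_ae ?_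
  filter_upwards [Lp.coeFn_star (χ.toLp 2 volume), χ.coeFn_toLp 2 volume,
    (memLp_tfShift hb w).coeFn_toLp] with t h1 h2 h3
  rw [h1, Pi.star_apply, h2, tfShiftLp, h3, RCLike.inner_apply, mul_comm]
  simp

lemma inner_tfShiftLp_toLp {b : Rn d → ℂ} (hb : MemLp b 2) (w : Phase d) (ψ : 𝓢(Rn d, ℂ)) :
    ⟪tfShiftLp hb w, ψ.toLp 2 volume⟫_ℂ = ∫ t, starRingEnd ℂ (tfShift w b t) * ψ t := by
  rw [inner_tfShiftLp]
  refine integral_congr_ae ?_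
  filter_upwards [ψ.coeFn_toLp 2 volume] with t h
  rw [h]

/-- An operator given by integrating the rank one operators attached to the atoms extends the
quantization of the convolution. -/
lemma isL2Extension_of_inner_eq {p : ℝ≥0∞} [Fact (1 ≤ p)] (φ : 𝓢(Phase d, ℂ))
    (a : Lp ℂ p (volume : Measure (Phase d))) {T : L2 d →L[ℂ] L2 d} {m : ℕ}
    (hu : ∀ τ : Rn d, MemLp (atomLeft m τ) 2)
    (hint : ∀ f e : L2 d, Integrable (fun q : Rn d × Phase d => a q.2 *
      (⟪f, tfShiftLp (hu q.1) q.2⟫_ℂ *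
        ⟪tfShiftLp (memLp_atomRight m (symplecticFourier d φ) q.1) q.2, e⟫_ℂ))
      (volume.prod volume))
    (hT : ∀ f e : L2 d, ⟪f, T e⟫_ℂ = ∫ q : Rn d × Phase d, a q.2 *
      (⟪f, tfShiftLp (hu q.1) q.2⟫_ℂ *
        ⟪tfShiftLp (memLp_atomRight m (symplecticFourier d φ) q.1) q.2, e⟫_ℂ)
      ∂(volume.prod volume)) :
    IsL2Extension (weyl (convDistrib (Lp.toTemperedDistribution a) φ)) T := by
  intro ψ
  ext χ
  rw [toTemperedDistribution_eq_inner, hT, integral_prod_symm _ (hint _ _)]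
  -- Quantization and convolution are defined by transposition, so the coefficient is `a` applied to
  -- the successive transforms of `χ ⊗ ψ`, the function computed in `weyl_separated`.
  change _ = Lp.toTemperedDistribution a (correlation φ (reflect d (symplecticFourier d
    (partialFourier (compCLMOfContinuousLinearEquiv ℂ (kernelCoords d) (tensorLeft ψ χ))))))
  rw [Lp.toTemperedDistribution_apply]
  refine integral_congr_ae (Filter.Eventually.of_forall fun w => ?_)
  dsimp only
  rw [weyl_separated m, integral_const_mul, smul_eq_mul, mul_comm]
  congr 1
  refine integral_congr_ae (Filter.Eventually.of_forall fun τ => ?_)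
  beta_reduce
  rw [inner_star_tfShiftLp, inner_tfShiftLp_toLp]

end Extension

end WeylCalc
end

/-! ### The theorem -/

theorem theorem4p1 (d : ℕ) :
    ∃ C : ℝ, 0 < C ∧ ∀ (φ : 𝓢(WeylCalc.Phase d, ℂ)) (p : ℝ≥0∞) [Fact (1 ≤ p)]
      (a : Lp ℂ p (volume : Measure (WeylCalc.Phase d))),
      ∃ T : WeylCalc.L2 d →L[ℂ] WeylCalc.L2 d,
        WeylCalc.IsL2Extension
          (WeylCalc.weyl (WeylCalc.convDistrib (Lp.toTemperedDistribution a) φ)) T ∧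
        WeylCalc.MemSchatten p T ∧
        WeylCalc.schattenNorm p T ≤
          ENNReal.ofReal C *
            WeylCalc.weightedNorm (4 * d + 2) (WeylCalc.symplecticFourier d φ) * ‖a‖ₑ := by
  -- The weight exponent is `m = d`, large enough for `memLp_decay`. It uses `4 * d` of the `4 * d +
  -- 2` orders available.
  obtain ⟨C, hC⟩ := WeylCalc.exists_weightedKernel_bound d d (by omega)
  set D := eLpNorm (fun t : WeylCalc.Rn d => (WeylCalc.decay d t : ℂ)) 2 volume with hD
  have hDtop : D ≠ ⊤ := WeylCalc.memLp_decay.eLpNorm_ne_top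
  have hconst : D * D * C ≤ ENNReal.ofReal ((D * D * C).toReal + 1) := by
    rw [ENNReal.ofReal_add ENNReal.toReal_nonneg zero_le_one, ENNReal.ofReal_toReal
      (ENNReal.mul_ne_top (ENNReal.mul_ne_top hDtop hDtop) ENNReal.coe_ne_top)]
    exact le_self_add
  -- The summand `1` only ensures that the constant is positive.
  refine ⟨(D * D * C).toReal + 1, by positivity, fun φ p _ a => ?_⟩
  set Φ := WeylCalc.symplecticFourier d φ with hΦ
  have hu := WeylCalc.besselFamily_tfShiftLp (WeylCalc.memLp_atomLeft (d := d))
    (WeylCalc.continuous_atomLeft d).measurable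
  have hv := WeylCalc.besselFamily_tfShiftLp (WeylCalc.memLp_atomRight d Φ)
    (WeylCalc.continuous_atomRight d Φ).measurable
  -- One factor `D` is the norm of the left atoms, constant in `τ`; the other comes from
  -- Cauchy–Schwarz applied to the right atoms.
  have hK : ∫⁻ τ, eLpNorm (WeylCalc.atomLeft d τ) 2 volume *
      eLpNorm (WeylCalc.atomRight d Φ τ) 2 volume ≤ D * (D * (∫⁻ z : WeylCalc.Phase d,
        ‖(((1 + ‖z.2‖ ^ 2) ^ d : ℝ) : ℂ) * WeylCalc.weightedKernel d Φ z‖ₑ ^ (2 : ℝ)) ^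
          (1 / 2 : ℝ)) := by
    simp only [WeylCalc.eLpNorm_atomLeft, ← hD]
    rw [lintegral_const_mul' _ _ hDtop]
    exact mul_le_mul_right (WeylCalc.lintegral_eLpNorm_atomRight_le d Φ) D
  have hKtop := ne_top_of_le_ne_top (ENNReal.mul_ne_top hDtop
    (ENNReal.mul_ne_top hDtop (WeylCalc.weightedKernel_lintegral_ne_top d Φ))) hK
  obtain ⟨T, hT, hmem, hnorm⟩ := WeylCalc.BesselFamily.exists_memSchatten hu hv hKtop a
  refine ⟨T, WeylCalc.isL2Extension_of_inner_eq φ a WeylCalc.memLp_atomLeft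
    (fun f e => WeylCalc.BesselFamily.integrable_mul hu hv hKtop a f e) hT, hmem, hnorm.trans ?_⟩
  refine mul_le_mul_left (hK.trans ?_) ‖a‖ₑ
  calc _ ≤ D * (D * (C * WeylCalc.weightedNorm (4 * d + 2) Φ)) := by
        gcongr
        exact hC Φ
    _ = (D * D * C) * WeylCalc.weightedNorm (4 * d + 2) Φ := by ring
    _ ≤ _ := by gcongr
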